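/- Lemma (Fractional Perfect Hash Lemma). Write $[k]$ for a set of $k$ elements. There is an absolute constant $c\in\mathbb N$ such that for all integers $1\le t\le n$ there is a non-empty set $\mathcal H^{n,t}\subseteq [t]^{[n]}$ of maps $[n]\to[t]$ with the following properties. (Explicitness) There is a single deterministic algorithm which, on input $(n,t)$ with $1\le t\le n$, lists the value tables of all members of $\mathcal H^{n,t}$ (repetitions in the list are allowed) in time at most $c\,(n\,|\mathcal H^{n,t}|)^{c}$, that is, polynomial in the size of the description of $\mathcal H^{n,t}$. Time is counted as the number of steps of a random access machine whose arithmetic operations are addition and truncated subtraction of natural numbers, each of unit cost. (Size) $|\mathcal H^{n,t}|\le 2^{ct}\,n^{c}$. (Hashing) For every $z\in[0,1]^n$ with $\sum_{j\in[n]}z_j\ge 10t$, if $h$ is chosen uniformly at random from $\mathcal H^{n,t}$ then $$\Pr_{h\in\mathcal H^{n,t}}\Bigl[\ \forall i\in[t]:\ 0.01\,M\le \sum_{j\in h^{-1}(i)}z_j\le 10\,M\ \Bigr]\ \ge\ \frac1{2^{ct}},\qquad M=\frac{\sum_{j\in[n]}z_j}{t}.$$ -/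

import Mathlib

/-! ### Algorithms: structured programs on a unit-cost random access machine

All cells hold natural numbers. The only arithmetic is addition and truncated subtraction, so the
number of steps is polynomially related to the running time of a Turing machine. -/

namespace RAM

/-- Expressions; `load a` is the content of the memory cell whose address is the value of `a`. -/
inductive Expr : Type
  | const (k : ℕ)
  | reg (r : ℕ)
  | load (a : Expr)
  | add (a b : Expr)
  | sub (a b : Expr)

/-- Programs. Conditions count as true when their value is nonzero; `emit` writes one number to
the write-only output tape. -/
inductive Prog : Type
  | skip
  | assign (r : ℕ) (e : Expr)
  | store (a e : Expr)
  | emit (e : Expr)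
  | seq (p q : Prog)
  | ite (e : Expr) (p q : Prog)
  | while (e : Expr) (p : Prog)

/-- A configuration: registers, memory cells, and the output written so far (in order). -/
structure State : Type where
  reg : ℕ → ℕ
  mem : ℕ → ℕ
  out : List ℕ

/-- Value of an expression. -/
def Expr.eval (s : State) : Expr → ℕ
  | const k => k
  | reg r => s.reg r
  | load a => s.mem (a.eval s)
  | add a b => a.eval s + b.eval s
  | sub a b => a.eval s - b.eval s

/-- Number of steps needed to evaluate an expression: one for each operation in it. -/
def Expr.cost : Expr → ℕ
  | const _ => 1
  | reg _ => 1
  | load a => a.cost + 1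
  | add a b => a.cost + b.cost + 1
  | sub a b => a.cost + b.cost + 1

/-- `Exec p s s' T`: started in `s`, the program `p` halts in `s'` after exactly `T` steps. -/
inductive Exec : Prog → State → State → ℕ → Prop
  | skip (s : State) : Exec Prog.skip s s 1
  | assign (r : ℕ) (e : Expr) (s : State) :
      Exec (Prog.assign r e) s { s with reg := Function.update s.reg r (e.eval s) } (e.cost + 1)
  | store (a e : Expr) (s : State) :
      Exec (Prog.store a e) s { s with mem := Function.update s.mem (a.eval s) (e.eval s) }
        (a.cost + e.cost + 1)
  | emit (e : Expr) (s : State) :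
      Exec (Prog.emit e) s { s with out := s.out ++ [e.eval s] } (e.cost + 1)
  | seq {p q : Prog} {s s' s'' : State} {T T' : ℕ} (hp : Exec p s s' T) (hq : Exec q s' s'' T') :
      Exec (Prog.seq p q) s s'' (T + T')
  | ite_true {e : Expr} {p q : Prog} {s s' : State} {T : ℕ} (he : e.eval s ≠ 0)
      (hp : Exec p s s' T) : Exec (Prog.ite e p q) s s' (e.cost + 1 + T)
  | ite_false {e : Expr} {p q : Prog} {s s' : State} {T : ℕ} (he : e.eval s = 0)
      (hq : Exec q s s' T) : Exec (Prog.ite e p q) s s' (e.cost + 1 + T)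
  | while_true {e : Expr} {p : Prog} {s s' s'' : State} {T T' : ℕ} (he : e.eval s ≠ 0)
      (hp : Exec p s s' T) (hw : Exec (Prog.while e p) s' s'' T') :
      Exec (Prog.while e p) s s'' (e.cost + 1 + T + T')
  | while_false {e : Expr} {p : Prog} {s : State} (he : e.eval s = 0) :
      Exec (Prog.while e p) s s (e.cost + 1)

/-- Start configuration on input `(n, t)`: the input in registers `0` and `1`, all else zero. -/
def init (n t : ℕ) : State where
  reg r := if r = 0 then n else if r = 1 then t else 0
  mem _ := 0
  out := []

/-- On input `(n, t)` the program halts after at most `T` steps with output `o`. -/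
def OutputsWithin (p : Prog) (n t : ℕ) (o : List ℕ) (T : ℕ) : Prop :=
  ∃ (s : State) (T' : ℕ), Exec p (init n t) s T' ∧ s.out = o ∧ T' ≤ T

end RAM

namespace FracHash

/-- The description of a list of maps `[n] → [t]`: their tables of values, one after the other. -/
def describe {n t : ℕ} (L : List (Fin n → Fin t)) : List ℕ :=
  L.flatMap fun h => List.ofFn fun j => (h j : ℕ)

/-- The sets `H n t` of maps `[n] → [t]` (for `1 ≤ t ≤ n`) are explicit: one program, given `n` and
`t`, lists the tables of all members of `H n t` in time polynomial in the size `n * |H n t|` of this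
description. -/
def IsExplicit (H : (n t : ℕ) → Finset (Fin n → Fin t)) : Prop :=
  ∃ (p : RAM.Prog) (c : ℕ), ∀ n t : ℕ, 1 ≤ t → t ≤ n →
    ∃ L : List (Fin n → Fin t), (∀ h, h ∈ L ↔ h ∈ H n t) ∧
      RAM.OutputsWithin p n t (describe L) (c * (n * (H n t).card) ^ c)

/-- Every bucket of `h` has total weight in `[0.01 M, 10 M]`, where `M = (∑ j, z j) / t`. -/
def IsBalanced {n t : ℕ} (z : Fin n → ℝ) (h : Fin n → Fin t) : Prop :=
  ∀ i : Fin t, (∑ j with h j = i, z j) ∈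
    Set.Icc (0.01 * ((∑ j, z j) / t)) (10 * ((∑ j, z j) / t))

open Classical in
/-- The probability that a uniformly random member of `H` satisfies `P`. -/
noncomputable def prob {α : Type*} (H : Finset α) (P : α → Prop) : ℝ :=
  ((H.filter P).card : ℝ) / (H.card : ℝ)

end FracHash

/-! A family of maps `[n] → [t]` that balances every fractional weight vector with probability
exponentially small in `t` only, together with a program that lists it.

Let `z` have total weight `t * M` with `M ≥ 10`. A member of the family is composed of three maps.

* A multiplicative hash function `j ↦ ⌊(a * j mod n * m) / n⌋` into `m = O(t ^ 2)` cells. It needs no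
  prime modulus: two given points collide for at most `4 * n` of the `n * m` multipliers `a`
  (`card_cellHash_eq_le`), because the multiples of a number less than `n` are equally spaced on the
  cycle of length `n * m`. By Markov's inequality half of the multipliers make the loads of all cells
  at most `M / 5`. This is the only step with `poly(n)` choices, and it succeeds for half of them.
* A map from the cells to `O(t)` slots of load at most `3 / 5 * M` (`exists_slot_load_le`). It uses
  hash functions of the same kind, into `2 ^ i` slots on level `i`. On each level, from the highest
  on, overloaded slots are closed and their content is passed on to the next lower level. For a good
  multiplier this at least halves the remaining weight, in step with the number of slots, so that the
  open slots are described by `O(t)` bits and the multipliers by `O((log t) ^ 2)` bits.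
* A monotone map from the slots to the `t` buckets, given by one bit for each slot: starting a new
  bucket whenever the partial sums pass a multiple of `M` works (`exists_grouping`).

The last two maps have only `2 ^ O(t)` descriptions, so that a single good one suffices.

The family is a set, and different parameters could give the same map: if this happened to the good
maps more often than to others, the fraction of good maps would drop. Therefore the domain is cut into
`O(t)` blocks. On one of them, which can be chosen of weight at most `M / 64`, the map is replaced by
a signature that determines `a` up to `2 ^ O(t)` possibilities (`div_sigWidth_eq`). Finally `2 ^ t`
simple maps are added; they ensure that the family is not much smaller than the number of parameters,
so that the time of the enumeration is polynomial in the size of the output.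

The program is verified with a Hoare-style predicate `RAM.Runs` that bounds the number of steps. -/

namespace RAM

/-! ### A program logic with step counts -/

/-- The state `s` with the value `v` in register `r`. -/
def State.set (s : State) (r v : ℕ) : State := { s with reg := Function.update s.reg r v }

@[simp] theorem State.set_reg (s : State) (r v : ℕ) :
    (s.set r v).reg = Function.update s.reg r v := rfl

@[simp] theorem State.set_out (s : State) (r v : ℕ) : (s.set r v).out = s.out := rfl

/-- The program `p`, started in `s`, halts within `T` steps in a state satisfying `Q`. -/
def Runs (p : Prog) (s : State) (T : ℕ) (Q : State → Prop) : Prop :=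
  ∃ (s' : State) (T' : ℕ), Exec p s s' T' ∧ T' ≤ T ∧ Q s'

/-- The registers below `k` and the output are the same in both states. Every subroutine below takes
a number `k`, writes only to registers from `k` on, and therefore preserves `Frame k`. -/
def Frame (k : ℕ) (s s' : State) : Prop :=
  (∀ r < k, s'.reg r = s.reg r) ∧ s'.out = s.out

theorem Frame.refl (k : ℕ) (s : State) : Frame k s s := ⟨fun _ _ => rfl, rfl⟩

theorem Frame.trans {k : ℕ} {s s' s'' : State} (h : Frame k s s') (h' : Frame k s' s'') :
    Frame k s s'' :=
  ⟨fun r hr => (h'.1 r hr).trans (h.1 r hr), h'.2.trans h.2⟩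

theorem Frame.mono {k l : ℕ} {s s' : State} (h : Frame l s s') (hkl : k ≤ l) : Frame k s s' :=
  ⟨fun r hr => h.1 r (hr.trans_le hkl), h.2⟩

theorem Frame.update {k r v : ℕ} {s s' : State} (h : Frame k s s') (hr : k ≤ r) :
    Frame k s (s'.set r v) :=
  ⟨fun q hq => by
    simp only [State.set_reg, Function.update_of_ne (show q ≠ r by omega)]; exact h.1 q hq, h.2⟩

theorem Runs.mono {p : Prog} {s : State} {T T' : ℕ} {Q Q' : State → Prop} (h : Runs p s T Q)
    (hT : T ≤ T') (hQ : ∀ s', Q s' → Q' s') : Runs p s T' Q' := by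
  obtain ⟨s', U, he, hU, hs'⟩ := h
  exact ⟨s', U, he, hU.trans hT, hQ s' hs'⟩

theorem Runs.skip {s : State} {Q : State → Prop} (h : Q s) : Runs Prog.skip s 1 Q :=
  ⟨s, 1, Exec.skip s, le_rfl, h⟩

theorem Runs.assign {r : ℕ} {e : Expr} {s : State} {Q : State → Prop}
    (h : Q (s.set r (e.eval s))) :
    Runs (Prog.assign r e) s (e.cost + 1) Q :=
  ⟨_, _, Exec.assign r e s, le_rfl, h⟩

theorem Runs.emit {e : Expr} {s : State} {Q : State → Prop}
    (h : Q { s with out := s.out ++ [e.eval s] }) : Runs (Prog.emit e) s (e.cost + 1) Q :=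
  ⟨_, _, Exec.emit e s, le_rfl, h⟩

theorem Runs.seq {p q : Prog} {s : State} {T T' : ℕ} {Q : State → Prop}
    (h : Runs p s T fun s' => Runs q s' T' Q) : Runs (Prog.seq p q) s (T + T') Q := by
  obtain ⟨s', U, he, hU, s'', U', he', hU', hQ⟩ := h
  exact ⟨s'', U + U', Exec.seq he he', by omega, hQ⟩

theorem Runs.ite {e : Expr} {p q : Prog} {s : State} {T : ℕ} {Q : State → Prop}
    (hp : e.eval s ≠ 0 → Runs p s T Q) (hq : e.eval s = 0 → Runs q s T Q) :
    Runs (Prog.ite e p q) s (e.cost + 1 + T) Q := by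
  by_cases he : e.eval s = 0
  · obtain ⟨s', U, hx, hU, hQ⟩ := hq he
    exact ⟨s', _, Exec.ite_false he hx, by omega, hQ⟩
  · obtain ⟨s', U, hx, hU, hQ⟩ := hp he
    exact ⟨s', _, Exec.ite_true he hx, by omega, hQ⟩

/-- The rule for loops whose number `k` of rounds is known: `I i` holds after `i` rounds. -/
theorem Runs.while {e : Expr} {p : Prog} {T : ℕ} {Q : State → Prop} (I : ℕ → State → Prop) (k : ℕ)
    (hstep : ∀ i < k, ∀ s', I i s' → e.eval s' ≠ 0 ∧ Runs p s' T (I (i + 1)))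
    (hend : ∀ s', I k s' → e.eval s' = 0 ∧ Q s') {s : State} (h0 : I 0 s) :
    Runs (Prog.while e p) s (k * (e.cost + 1 + T) + (e.cost + 1)) Q := by
  suffices H : ∀ d i s', i + d = k → I i s' →
      Runs (Prog.while e p) s' (d * (e.cost + 1 + T) + (e.cost + 1)) Q from
    H k 0 s (by omega) h0
  intro d
  induction d with
  | zero =>
    intro i s' hi hI
    obtain rfl : i = k := by omega
    obtain ⟨he, hQ⟩ := hend s' hI
    exact ⟨s', _, Exec.while_false he, by omega, hQ⟩
  | succ d ih =>
    intro i s' hi hI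
    obtain ⟨he, s₁, U, hx, hU, hI'⟩ := hstep i (by omega) s' hI
    obtain ⟨s₂, U', hx', hU', hQ⟩ := ih (i + 1) s₁ (by omega) hI'
    refine ⟨s₂, _, Exec.while_true he hx hx', ?_, hQ⟩
    rw [Nat.succ_mul]
    omega

/-! ### Arithmetic subroutines -/

/-- Quotient (register `k`) and remainder (register `k + 1`) of register `x` by register `d`. -/
def divMod (k x d : ℕ) : Prog :=
  .seq (.assign k (.const 0)) <|
  .seq (.assign (k + 1) (.reg x)) <|
  .while (.sub (.add (.reg (k + 1)) (.const 1)) (.reg d)) <|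
    .seq (.assign (k + 1) (.sub (.reg (k + 1)) (.reg d)))
      (.assign k (.add (.reg k) (.const 1)))

theorem runs_divMod {k x d U : ℕ} (hx : x < k) (hd : d < k) {s : State} (h0 : 0 < s.reg d)
    (hU : s.reg x ≤ U) (hU1 : 1 ≤ U) :
    Runs (divMod k x d) s (30 * U) fun s' => s'.reg k = s.reg x / s.reg d ∧
      s'.reg (k + 1) = s.reg x % s.reg d ∧ Frame k s s' := by
  have hq : s.reg x / s.reg d ≤ U := (Nat.div_le_self _ _).trans hU
  refine Runs.mono (T := 2 + (2 + (s.reg x / s.reg d * (6 + 8) + 6))) ?_ (by omega)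
    (fun _ h => h)
  refine Runs.seq (Runs.assign (Runs.seq (Runs.assign ?_)))
  refine Runs.while (T := 8) (fun i s' => s.reg x = i * s.reg d + s'.reg (k + 1) ∧
    s'.reg k = i ∧ Frame k s s') _ ?_ ?_ ?_
  · rintro i hi s' ⟨h1, h2, h3⟩
    have hle : (i + 1) * s.reg d ≤ s.reg x := (Nat.le_div_iff_mul_le h0).1 hi
    rw [Nat.succ_mul] at hle
    have hdd := h3.1 d hd
    refine ⟨by simp only [Expr.eval]; omega, ?_⟩
    refine Runs.seq (T := 4) (T' := 4) (Runs.assign (Runs.assign ⟨?_, ?_, ?_⟩))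
    · simp [Expr.eval, Nat.succ_mul]; omega
    · simp [Expr.eval, h2]
    · exact (h3.update (by omega)).update le_rfl
  · rintro s' ⟨h1, h2, h3⟩
    have hm := Nat.div_add_mod (s.reg x) (s.reg d)
    rw [mul_comm] at hm
    have hlt := Nat.mod_lt (s.reg x) h0
    have hdd := h3.1 d hd
    exact ⟨by simp only [Expr.eval]; omega, h2, by omega, h3⟩
  · refine ⟨?_, ?_, ((Frame.refl k s).update le_rfl).update (by omega)⟩
    · simp [Expr.eval, Function.update_of_ne (show x ≠ k by omega)]
    · simp [Expr.eval]

/-- The product of the registers `x` and `y`, in register `k`. -/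
def mul (k x y : ℕ) : Prog :=
  .seq (.assign k (.const 0)) <|
  .seq (.assign (k + 1) (.reg y)) <|
  .while (.reg (k + 1)) <|
    .seq (.assign k (.add (.reg k) (.reg x)))
      (.assign (k + 1) (.sub (.reg (k + 1)) (.const 1)))

theorem runs_mul {k x y U : ℕ} (hx : x < k) (hy : y < k) {s : State}
    (hU : s.reg y ≤ U) (hU1 : 1 ≤ U) :
    Runs (mul k x y) s (30 * U) fun s' => s'.reg k = s.reg x * s.reg y ∧ Frame k s s' := by
  refine Runs.mono (T := 2 + (2 + (s.reg y * (2 + 8) + 2))) ?_ (by omega) (fun _ h => h)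
  refine Runs.seq (Runs.assign (Runs.seq (Runs.assign ?_)))
  refine Runs.while (T := 8) (fun i s' => s'.reg k = s.reg x * i ∧
    s'.reg (k + 1) = s.reg y - i ∧ Frame k s s') _ ?_ ?_ ?_
  · rintro i hi s' ⟨h1, h2, h3⟩
    have hxx := h3.1 x hx
    refine ⟨by simp only [Expr.eval]; omega, ?_⟩
    refine Runs.seq (T := 4) (T' := 4) (Runs.assign (Runs.assign ⟨?_, ?_, ?_⟩))
    · simp [Expr.eval, h1, hxx, Nat.mul_succ]
    · simp [Expr.eval]; omega
    · exact (h3.update le_rfl).update (by omega)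
  · rintro s' ⟨h1, h2, h3⟩
    exact ⟨by simp only [Expr.eval]; omega, h1, h3⟩
  · refine ⟨?_, ?_, ((Frame.refl k s).update le_rfl).update (by omega)⟩
    · simp [Expr.eval]
    · simp [Expr.eval, Function.update_of_ne (show y ≠ k by omega)]

/-- `(a * j % N) / n` in register `k`, for registers `a`, `j`, `N`, `n`. -/
def mulModDiv (k a j N n : ℕ) : Prog :=
  .seq (mul k a j) <|
  .seq (divMod (k + 1) k N) <|
  .seq (divMod (k + 3) (k + 2) n) <|
  .assign k (.reg (k + 3))

theorem runs_mulModDiv {k a j N n U : ℕ} (ha : a < k) (hj : j < k) (hN : N < k) (hn : n < k)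
    {s : State} (hN0 : 0 < s.reg N) (hn0 : 0 < s.reg n) (hjU : s.reg j ≤ U)
    (hU : s.reg a * s.reg j ≤ U) (hU1 : 1 ≤ U) :
    Runs (mulModDiv k a j N n) s (100 * U) fun s' =>
      s'.reg k = (s.reg a * s.reg j % s.reg N) / s.reg n ∧ Frame k s s' := by
  refine Runs.mono (T := 30 * U + (30 * U + (30 * U + 2))) ?_ (by omega) (fun _ h => h)
  refine Runs.seq ((runs_mul ha hj hjU hU1).mono le_rfl ?_)
  rintro s₁ ⟨h1, f1⟩
  have e1 := f1.1 N hN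
  refine Runs.seq ((runs_divMod (U := U) (by omega) (by omega) (by omega) (by omega) hU1).mono
    le_rfl ?_)
  rintro s₂ ⟨-, h2, f2⟩
  have e2 := f1.1 n hn
  have e3 := f2.1 n (by omega)
  have hle : s₂.reg (k + 2) ≤ U := by
    rw [h2, h1]; exact (Nat.mod_le _ _).trans hU
  refine Runs.seq ((runs_divMod (U := U) (by omega) (by omega) (by omega) hle hU1).mono
    le_rfl ?_)
  rintro s₃ ⟨h3, -, f3⟩
  refine Runs.assign ⟨?_, ?_⟩
  · simp [Expr.eval, h3, e3, e2, h2, h1, e1]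
  · exact ((f1.trans (f2.mono (by omega))).trans (f3.mono (by omega))).update le_rfl

end RAM

namespace FracHash

/-- The number of ones among the `p` lowest binary digits of `x`. -/
def rank (x p : ℕ) : ℕ := ∑ q ∈ Finset.range p, x / 2 ^ q % 2

end FracHash

namespace RAM

open FracHash

/-- For registers `x` and `p`: the number of ones among the lowest `p` bits of `x` in register `k`,
and `x` shifted by `p` bits in register `k + 1`. -/
def scan (k x p : ℕ) : Prog :=
  .seq (.assign k (.const 0)) <|
  .seq (.assign (k + 1) (.reg x)) <|
  .seq (.assign (k + 2) (.reg p)) <|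
  .seq (.assign (k + 3) (.const 2)) <|
  .while (.reg (k + 2)) <|
    .seq (divMod (k + 4) (k + 1) (k + 3)) <|
    .seq (.assign k (.add (.reg k) (.reg (k + 5)))) <|
    .seq (.assign (k + 1) (.reg (k + 4)))
      (.assign (k + 2) (.sub (.reg (k + 2)) (.const 1)))

theorem runs_scan {k x p U : ℕ} (hx : x < k) (hp : p < k) {s : State} (hxU : s.reg x ≤ U)
    (hpU : s.reg p ≤ U) (hU1 : 1 ≤ U) :
    Runs (scan k x p) s (60 * U ^ 2) fun s' => s'.reg k = rank (s.reg x) (s.reg p) ∧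
      s'.reg (k + 1) = s.reg x / 2 ^ s.reg p ∧ s'.reg (k + 3) = 2 ∧ Frame k s s' := by
  refine Runs.mono (T := 2 + (2 + (2 + (2 + (s.reg p * (2 + (30 * U + (4 + (2 + 4)))) + 2)))))
    ?_ ?_ (fun _ h => h)
  swap
  · have := Nat.mul_le_mul_right (2 + (30 * U + (4 + (2 + 4)))) hpU
    nlinarith
  refine Runs.seq (Runs.assign (Runs.seq (Runs.assign (Runs.seq (Runs.assign (Runs.seq
    (Runs.assign ?_)))))))
  refine Runs.while (fun i s' => s'.reg k = rank (s.reg x) i ∧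
    s'.reg (k + 1) = s.reg x / 2 ^ i ∧ s'.reg (k + 2) = s.reg p - i ∧ s'.reg (k + 3) = 2 ∧
    Frame k s s') _ ?_ ?_ ?_
  · rintro i hi s₀ ⟨h1, h2, h3, h4, h5⟩
    refine ⟨by simp only [Expr.eval]; omega, ?_⟩
    have hle : s₀.reg (k + 1) ≤ U := by
      rw [h2]; exact (Nat.div_le_self _ _).trans hxU
    refine Runs.seq ((runs_divMod (U := U) (by omega) (by omega) (by omega) hle hU1).mono
      le_rfl ?_)
    rintro s₁ ⟨g1, g2, g3⟩
    have e1 := g3.1 k (by omega)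
    have e2 := g3.1 (k + 1) (by omega)
    have e3 := g3.1 (k + 2) (by omega)
    have e4 := g3.1 (k + 3) (by omega)
    refine Runs.seq (Runs.assign (Runs.seq (Runs.assign (Runs.assign ⟨?_, ?_, ?_, ?_, ?_⟩))))
    · simp [Expr.eval, rank, Finset.sum_range_succ, e1, g2, h1, h2, h4]
    · simp [Expr.eval, g1, h2, h4, Nat.div_div_eq_div_mul, pow_succ]
    · simp [Expr.eval, e3, h3]; omega
    · simp [e4, h4]
    · exact (((h5.trans (g3.mono (by omega))).update le_rfl).update (by omega)).update (by omega)
  · rintro s' ⟨h1, h2, h3, h4, h5⟩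
    exact ⟨by simp only [Expr.eval]; omega, h1, h2, h4, h5⟩
  · refine ⟨by simp [Expr.eval, rank], ?_, ?_, by simp [Expr.eval],
      ((((Frame.refl k s).update le_rfl).update (by omega)).update (by omega)).update (by omega)⟩
    · simp [Expr.eval, Function.update_of_ne (show x ≠ k by omega)]
    · simp [Expr.eval, Function.update_of_ne (show p ≠ k by omega),
        Function.update_of_ne (show p ≠ k + 1 by omega)]

/-- The bit number `p` of `x` in register `k`, for registers `x` and `p`. -/
def bit (k x p : ℕ) : Prog :=
  .seq (scan k x p) <|
  .seq (divMod (k + 4) (k + 1) (k + 3)) <|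
  .assign k (.reg (k + 5))

theorem runs_bit {k x p U : ℕ} (hx : x < k) (hp : p < k) {s : State} (hxU : s.reg x ≤ U)
    (hpU : s.reg p ≤ U) (hU1 : 1 ≤ U) :
    Runs (bit k x p) s (100 * U ^ 2) fun s' => s'.reg k = s.reg x / 2 ^ s.reg p % 2 ∧
      Frame k s s' := by
  refine Runs.mono (T := 60 * U ^ 2 + (30 * U + 2)) ?_ (by nlinarith) (fun _ h => h)
  refine Runs.seq ((runs_scan hx hp hxU hpU hU1).mono le_rfl ?_)
  rintro s₁ ⟨-, h1, h2, f1⟩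
  have hle : s₁.reg (k + 1) ≤ U := by
    rw [h1]; exact (Nat.div_le_self _ _).trans hxU
  refine Runs.seq ((runs_divMod (U := U) (by omega) (by omega) (by omega) hle hU1).mono
    le_rfl ?_)
  rintro s₂ ⟨-, h3, f2⟩
  refine Runs.assign ⟨?_, (f1.trans (f2.mono (by omega))).update le_rfl⟩
  simp [Expr.eval, h3, h1, h2]

end RAM

namespace FracHash

/-! ### The family of maps -/

/-- A multiplicative hash function `[n] → [m]` with multiplier `a`, taken modulo `n * m`. -/
def cellHash (n m a j : ℕ) : ℕ := (a * j % (n * m)) / n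

theorem cellHash_lt {n m : ℕ} (hn : 0 < n) (hm : 0 < m) (a j : ℕ) : cellHash n m a j < m :=
  Nat.div_lt_of_lt_mul (Nat.mod_lt _ (Nat.mul_pos hn hm))

/-- The slot of `u` after `i` levels. Level `i` hashes with multiplier `α i` into the slots of
`[2 ^ i, 2 ^ (i + 1))`; the slot `c` is open if `β c ≠ 0`, and `u` goes to the open slot that the
highest level offers it, or to slot `0` if there is none. -/
def slot (m : ℕ) (α β : ℕ → ℕ) (u : ℕ) : ℕ → ℕ
  | 0 => 0
  | i + 1 =>
    if β (2 ^ i + cellHash m (2 ^ i) (α i) u) ≠ 0 then 2 ^ i + cellHash m (2 ^ i) (α i) u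
    else slot m α β u i

/-- Digit number `i` of `x` in base `b`. -/
def digit (b x i : ℕ) : ℕ := x / b ^ i % b

/-- The size of the range of the first hash function. -/
def fineCells (t : ℕ) : ℕ := 1024 * (t * t)

/-- The number of blocks into which the domain is cut; the slots are those below twice this. -/
def blocks (t : ℕ) : ℕ := 64 * t

/-- The number of consecutive multipliers that share a signature. This is also the base in which
the multipliers of the levels are encoded. -/
def sigWidth (t : ℕ) : ℕ := fineCells t * blocks t

/-- The range of each of the parameters of `value` other than the first multiplier. -/
def seeds (t : ℕ) : ℕ := 2 ^ (256 * t)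

/-- The number of levels. -/
def levels (t : ℕ) : ℕ := Nat.clog 2 (blocks t)

/-- The value at `j` of the map with parameters `a`, `r`, `X`, `Y`, `Z`, before truncation to `[t]`.
The block of the `j` congruent to `r` carries a signature of the multiplier `a`. Outside it, `j` is
hashed to a slot, and `Z` marks the slots after which a new bucket starts. For `r` too large to
denote a block, the values are the bits of `Y`. -/
def value (n t a r X Y Z j : ℕ) : ℕ :=
  if r < blocks t then
    if j % blocks t = r then if j / blocks t = a / sigWidth t then 1 else 0
    else rank Z (slot (fineCells t) (digit (sigWidth t) X) (digit 2 Y)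
      (cellHash n (fineCells t) a j) (levels t))
  else digit 2 Y j

end FracHash

namespace RAM

open FracHash

/-! ### The program -/

/-! The registers hold: `0` and `1` the input `n`, `t`; `2` to `6` the numbers `fineCells t`, `blocks t`,
`sigWidth t`, `n * fineCells t` and `seeds t`; `7` to `12` the parameters `a`, `r`, `X`, `Y`, `Z` and
the position `j`; `13` the value at `j`. -/

/-- Computes `FracHash.slot` for the register `u`, in register `k`. -/
def slotProg (k u : ℕ) : Prog :=
  .seq (.assign k (.const 0)) <|
  .seq (.assign (k + 1) (.const 1)) <|
  .seq (.assign (k + 2) (.reg 2)) <|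
  .seq (.assign (k + 3) (.reg 9)) <|
  .while (.sub (.reg 3) (.reg (k + 1))) <|
    .seq (divMod (k + 4) (k + 3) 4) <|
    .seq (mulModDiv (k + 6) (k + 5) u (k + 2) 2) <|
    .seq (.assign (k + 6) (.add (.reg (k + 1)) (.reg (k + 6)))) <|
    .seq (bit (k + 7) 10 (k + 6)) <|
    .seq (.ite (.reg (k + 7)) (.assign k (.reg (k + 6))) .skip) <|
    .seq (.assign (k + 3) (.reg (k + 4))) <|
    .seq (.assign (k + 1) (.add (.reg (k + 1)) (.reg (k + 1))))
      (.assign (k + 2) (.add (.reg (k + 2)) (.reg (k + 2))))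

theorem runs_slotProg {k u U : ℕ} (hk : 12 < k) (hu : u < k) {s : State} (h2 : 0 < s.reg 2)
    (h4 : 0 < s.reg 4) (hX : s.reg 9 ≤ U) (hY : s.reg 10 ≤ U) (hR : 2 * s.reg 3 ≤ U)
    (huU : s.reg u ≤ U) (hQU : s.reg 4 * s.reg u ≤ U) (hU1 : 1 ≤ U) :
    Runs (slotProg k u) s (500 * U ^ 3) fun s' =>
      s'.reg k = slot (s.reg 2) (digit (s.reg 4) (s.reg 9)) (digit 2 (s.reg 10)) (s.reg u)
        (Nat.clog 2 (s.reg 3)) ∧ Frame k s s' := by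
  set K := Nat.clog 2 (s.reg 3) with hK
  have hpow : ∀ i < K, 2 ^ i < s.reg 3 := fun i hi =>
    (Nat.lt_clog_iff_pow_lt (by norm_num)).1 hi
  have hKU : K ≤ U := by
    have h := Nat.clog_le_of_le_pow (b := 2) (x := s.reg 3) (y := s.reg 3) Nat.lt_two_pow_self.le
    omega
  refine Runs.mono (T := 2 + (2 + (2 + (2 + (K * (4 + (30 * U + (100 * U + (4 + (100 * U ^ 2 +
    ((2 + 2) + (2 + (4 + 4)))))))) + 4))))) ?_ ?_ (fun _ h => h)
  swap
  · have := Nat.mul_le_mul_right (4 + (30 * U + (100 * U + (4 + (100 * U ^ 2 +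
      ((2 + 2) + (2 + (4 + 4)))))))) hKU
    have h1 : U ≤ U ^ 3 := Nat.le_self_pow (by norm_num) U
    have h2 : U ^ 2 ≤ U ^ 3 := Nat.pow_le_pow_right hU1 (by norm_num)
    nlinarith
  refine Runs.seq (Runs.assign (Runs.seq (Runs.assign (Runs.seq (Runs.assign (Runs.seq
    (Runs.assign ?_)))))))
  refine Runs.while (fun i s' =>
    s'.reg k = slot (s.reg 2) (digit (s.reg 4) (s.reg 9)) (digit 2 (s.reg 10)) (s.reg u) i ∧
    s'.reg (k + 1) = 2 ^ i ∧ s'.reg (k + 2) = s.reg 2 * 2 ^ i ∧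
    s'.reg (k + 3) = s.reg 9 / s.reg 4 ^ i ∧ Frame k s s') _ ?_ ?_ ?_
  · rintro i hi s₀ ⟨a0, a1, a2, a3, f0⟩
    have e02 := f0.1 2 (by omega)
    have e03 := f0.1 3 (by omega)
    have e04 := f0.1 4 (by omega)
    have e10 := f0.1 10 (by omega)
    have e0u := f0.1 u hu
    have hp := hpow i hi
    have hp0 : 0 < 2 ^ i := by positivity
    refine ⟨by simp only [Expr.eval]; omega, ?_⟩
    have hle : s₀.reg (k + 3) ≤ U := by
      rw [a3]; exact (Nat.div_le_self _ _).trans hX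
    refine Runs.seq ((runs_divMod (U := U) (by omega) (by omega) (by omega) hle hU1).mono
      le_rfl ?_)
    rintro s₁ ⟨b4, b5, f1⟩
    have f1' := f0.trans (f1.mono (show k ≤ k + 4 by omega))
    have e12 := f1'.1 2 (by omega)
    have e1u := f1'.1 u hu
    have b2 := f1.1 (k + 2) (by omega)
    have hdig : s₁.reg (k + 5) = digit (s.reg 4) (s.reg 9) i := by
      rw [digit, b5, a3, e04]
    have hlt : s₁.reg (k + 5) < s.reg 4 := by
      rw [hdig]; exact Nat.mod_lt _ h4
    refine Runs.seq ((runs_mulModDiv (k := k + 6) (a := k + 5) (j := u) (N := k + 2) (n := 2)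
      (U := U) (by omega) (by omega) (by omega) (by omega)
      (by rw [b2, a2]; positivity) (by omega) (by omega)
      (by rw [e1u]; exact (Nat.mul_le_mul_right _ hlt.le).trans hQU) hU1).mono le_rfl ?_)
    rintro s₂ ⟨c6, f2⟩
    have hc6 : s₂.reg (k + 6) =
        cellHash (s.reg 2) (2 ^ i) (digit (s.reg 4) (s.reg 9) i) (s.reg u) := by
      rw [c6, hdig, e1u, e12, b2, a2, cellHash]
    have hclt := cellHash_lt h2 hp0 (digit (s.reg 4) (s.reg 9) i) (s.reg u)
    have f2' := f1'.trans (f2.mono (show k ≤ k + 6 by omega))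
    have c1 : s₂.reg (k + 1) = 2 ^ i := by
      rw [f2.1 (k + 1) (by omega), f1.1 (k + 1) (by omega), a1]
    refine Runs.seq (Runs.assign ?_)
    have f3 : Frame (k + 6) s₂
        (s₂.set (k + 6) ((Expr.add (.reg (k + 1)) (.reg (k + 6))).eval s₂)) := (Frame.refl _ _).update le_rfl
    have d6 : (s₂.set (k + 6) ((Expr.add (.reg (k + 1)) (.reg (k + 6))).eval s₂)).reg (k + 6) =
        2 ^ i + cellHash (s.reg 2) (2 ^ i) (digit (s.reg 4) (s.reg 9) i) (s.reg u) := by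
      simp [Expr.eval, c1, hc6]
    generalize (s₂.set (k + 6) ((Expr.add (.reg (k + 1)) (.reg (k + 6))).eval s₂)) = s₃ at f3 d6 ⊢
    have f3' := f2'.trans (f3.mono (show k ≤ k + 6 by omega))
    have g10 := f3'.1 10 (by omega)
    refine Runs.seq ((runs_bit (k := k + 7) (x := 10) (p := k + 6) (U := U) (by omega) (by omega)
      (by omega) (by omega) hU1).mono le_rfl ?_)
    rintro s₄ ⟨h7, f4⟩
    have f4' := f3'.trans (f4.mono (show k ≤ k + 7 by omega))
    have k6 : s₄.reg (k + 6) = s₃.reg (k + 6) := f4.1 _ (by omega)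
    have k0 : s₄.reg k = s₀.reg k := by
      rw [f4.1 _ (by omega), f3.1 _ (by omega), f2.1 _ (by omega), f1.1 _ (by omega)]
    have k1 : s₄.reg (k + 1) = 2 ^ i := by
      rw [f4.1 _ (by omega), f3.1 _ (by omega), c1]
    have k2 : s₄.reg (k + 2) = s.reg 2 * 2 ^ i := by
      rw [f4.1 _ (by omega), f3.1 _ (by omega), f2.1 _ (by omega), b2, a2]
    have k4 : s₄.reg (k + 4) = s.reg 9 / s.reg 4 ^ (i + 1) := by
      rw [f4.1 _ (by omega), f3.1 _ (by omega), f2.1 _ (by omega), b4, a3, e04,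
        Nat.div_div_eq_div_mul, pow_succ]
    refine Runs.seq (T := 2 + 2) (T' := 2 + (4 + 4)) ?_
    have hrest : ∀ s₅ : State, s₅.reg k = slot (s.reg 2) (digit (s.reg 4) (s.reg 9))
        (digit 2 (s.reg 10)) (s.reg u) (i + 1) → s₅.reg (k + 1) = 2 ^ i →
        s₅.reg (k + 2) = s.reg 2 * 2 ^ i → s₅.reg (k + 4) = s.reg 9 / s.reg 4 ^ (i + 1) →
        Frame k s s₅ → Runs (.seq (.assign (k + 3) (.reg (k + 4))) <|
        .seq (.assign (k + 1) (.add (.reg (k + 1)) (.reg (k + 1))))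
        (.assign (k + 2) (.add (.reg (k + 2)) (.reg (k + 2))))) s₅ (2 + (4 + 4)) fun s' =>
          s'.reg k = slot (s.reg 2) (digit (s.reg 4) (s.reg 9)) (digit 2 (s.reg 10)) (s.reg u)
            (i + 1) ∧ s'.reg (k + 1) = 2 ^ (i + 1) ∧ s'.reg (k + 2) = s.reg 2 * 2 ^ (i + 1) ∧
          s'.reg (k + 3) = s.reg 9 / s.reg 4 ^ (i + 1) ∧ Frame k s s' := by
      intro s₅ l0 l1 l2 l4 f5
      refine Runs.seq (Runs.assign (Runs.seq (T := 4) (T' := 4) (Runs.assign (Runs.assign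
        ⟨?_, ?_, ?_, ?_, ?_⟩))))
      · simp [l0]
      · simp [Expr.eval, l1, pow_succ, mul_two]
      · simp [Expr.eval, l2, pow_succ, mul_two, mul_add]
      · simp [Expr.eval, l4]
      · exact ((f5.update (by omega)).update (by omega)).update (by omega)
    refine Runs.ite (T := 2) (fun hne => Runs.assign ?_) (fun he => (Runs.skip ?_).mono
      (by norm_num) (fun _ h => h))
    · have hb : digit 2 (s.reg 10) (2 ^ i + cellHash (s.reg 2) (2 ^ i)
          (digit (s.reg 4) (s.reg 9) i) (s.reg u)) ≠ 0 := by
        rw [← d6, digit, ← g10, ← h7]; exact hne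
      refine hrest _ ?_ ?_ ?_ ?_ (f4'.update le_rfl)
      · simp only [State.set_reg, Function.update_self, Expr.eval, slot, if_pos hb]
        rw [k6, d6]
      · simp [k1]
      · simp [k2]
      · simp [k4]
    · have hb : ¬ digit 2 (s.reg 10) (2 ^ i + cellHash (s.reg 2) (2 ^ i)
          (digit (s.reg 4) (s.reg 9) i) (s.reg u)) ≠ 0 := by
        rw [not_not, ← d6, digit, ← g10, ← h7]; exact he
      refine hrest _ ?_ k1 k2 k4 f4'
      rw [slot, if_neg hb, k0, a0]
  · rintro s' ⟨a0, a1, a2, a3, f0⟩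
    refine ⟨?_, a0, f0⟩
    have e03 := f0.1 3 (by omega)
    have hle : s.reg 3 ≤ 2 ^ K := Nat.le_pow_clog (by norm_num) _
    simp only [Expr.eval]
    omega
  · have q2 : (2 : ℕ) ≠ k := by omega
    have q9 : (9 : ℕ) ≠ k := by omega
    have q21 : (2 : ℕ) ≠ k + 1 := by omega
    have q91 : (9 : ℕ) ≠ k + 1 := by omega
    have q92 : (9 : ℕ) ≠ k + 2 := by omega
    refine ⟨by simp [Expr.eval, slot], by simp [Expr.eval], ?_, ?_,
      ((((Frame.refl k s).update le_rfl).update (by omega)).update (by omega)).update (by omega)⟩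
    · simp [Expr.eval, Function.update_of_ne, q2, q21]
    · simp [Expr.eval, Function.update_of_ne, q9, q91, q92]

end RAM

namespace FracHash

theorem sigWidth_mul_fineCells_le (t : ℕ) : sigWidth t * fineCells t ≤ seeds t := by
  rcases Nat.eq_zero_or_pos t with rfl | ht
  · simp [sigWidth, fineCells]
  have h1 : t ≤ 2 ^ t := Nat.lt_two_pow_self.le
  have h2 : (2 : ℕ) ^ 26 ≤ 2 ^ (26 * t) := Nat.pow_le_pow_right (by norm_num) (by omega)
  calc sigWidth t * fineCells t = 2 ^ 26 * t ^ 5 := by simp only [sigWidth, fineCells, blocks]; ring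
    _ ≤ 2 ^ (26 * t) * (2 ^ t) ^ 5 := Nat.mul_le_mul h2 (Nat.pow_le_pow_left h1 5)
    _ = 2 ^ (31 * t) := by rw [← pow_mul, ← pow_add]; congr 1; ring
    _ ≤ seeds t := Nat.pow_le_pow_right (by norm_num) (by omega)

theorem fineCells_pos {t : ℕ} (ht : 1 ≤ t) : 0 < fineCells t := by
  unfold fineCells; positivity

theorem sigWidth_pos {t : ℕ} (ht : 1 ≤ t) : 0 < sigWidth t :=
  Nat.mul_pos (fineCells_pos ht) (by unfold blocks; omega)

theorem fineCells_le_seeds {t : ℕ} (ht : 1 ≤ t) : fineCells t ≤ seeds t :=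
  (Nat.le_mul_of_pos_left _ (sigWidth_pos ht)).trans (sigWidth_mul_fineCells_le t)

theorem sigWidth_le_seeds {t : ℕ} (ht : 1 ≤ t) : sigWidth t ≤ seeds t :=
  (Nat.le_mul_of_pos_right _ (fineCells_pos ht)).trans (sigWidth_mul_fineCells_le t)

theorem mul_blocks_le_seeds {t : ℕ} (ht : 1 ≤ t) : 4 * blocks t ≤ seeds t :=
  (Nat.mul_le_mul_right _ (by unfold fineCells; nlinarith)).trans (sigWidth_le_seeds ht)

theorem slot_lt {m : ℕ} (hm : 0 < m) (α β : ℕ → ℕ) (u i : ℕ) : slot m α β u i < 2 ^ i := by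
  induction i with
  | zero => simp [slot]
  | succ i ih =>
    have := cellHash_lt hm (show 0 < 2 ^ i by positivity) (α i) u
    rw [slot, pow_succ]
    split_ifs <;> omega

theorem two_pow_levels_lt {t : ℕ} (ht : 1 ≤ t) : 2 ^ levels t < 2 * blocks t := by
  have h1 : 0 < levels t := Nat.clog_pos (by norm_num) (by unfold blocks; omega)
  have h2 : 2 ^ (levels t - 1) < blocks t := (Nat.lt_clog_iff_pow_lt (by norm_num)).1 (by
    change levels t - 1 < levels t; omega)
  obtain ⟨k, hk⟩ : ∃ k, levels t = k + 1 := ⟨levels t - 1, by omega⟩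
  rw [hk] at h2 ⊢
  rw [pow_succ]
  simp only [Nat.add_sub_cancel] at h2
  omega

/-- All numbers that occur in the computation are at most this. -/
def timeUnit (n t : ℕ) : ℕ := n ^ 2 * seeds t

theorem timeUnit_bounds {n t : ℕ} (ht : 1 ≤ t) (hn : 1 ≤ n) :
    1 ≤ timeUnit n t ∧ seeds t ≤ timeUnit n t ∧ n ≤ timeUnit n t ∧
      n * fineCells t * n ≤ timeUnit n t ∧ n * fineCells t ≤ timeUnit n t := by
  have hV : 1 ≤ seeds t := Nat.one_le_two_pow
  have hn2 : n ≤ n ^ 2 := Nat.le_self_pow (by norm_num) n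
  have h1 : n * fineCells t * n ≤ timeUnit n t := by
    rw [timeUnit]
    nlinarith [Nat.mul_le_mul_left (n ^ 2) (fineCells_le_seeds ht)]
  have h2 : n ≤ timeUnit n t := by
    simpa [timeUnit] using Nat.mul_le_mul hn2 hV
  exact ⟨hn.trans h2, Nat.le_mul_of_pos_left _ (by positivity), h2, h1,
    (Nat.le_mul_of_pos_right _ hn).trans h1⟩

end FracHash

namespace RAM

open FracHash

/-- The constants computed before the enumeration starts are in place. -/
def Ready (n t : ℕ) (s : State) : Prop :=
  s.reg 0 = n ∧ s.reg 1 = t ∧ s.reg 2 = fineCells t ∧ s.reg 3 = blocks t ∧ s.reg 4 = sigWidth t ∧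
    s.reg 5 = n * fineCells t ∧ s.reg 6 = seeds t

/-- `Ready` depends only on the first seven registers. -/
theorem Ready.congr {n t : ℕ} {s s' : State} (h : Ready n t s) (he : ∀ r < 7, s'.reg r = s.reg r) :
    Ready n t s' := by
  unfold Ready at *
  rwa [he 0 (by omega), he 1 (by omega), he 2 (by omega), he 3 (by omega), he 4 (by omega),
    he 5 (by omega), he 6 (by omega)]

/-- Computes the value outside the signature block, in register `13`. -/
def hashProg : Prog :=
  .seq (mulModDiv 16 7 12 5 0) <| .seq (slotProg 17 16) <|
    .seq (scan 18 11 17) <| .assign 13 (.reg 18)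

theorem runs_hashProg {n t : ℕ} (ht : 1 ≤ t) {s : State} (hs : Ready n t s)
    (ha : s.reg 7 < n * fineCells t) (hX : s.reg 9 < seeds t)
    (hY : s.reg 10 < seeds t) (hZ : s.reg 11 < seeds t) (hj : s.reg 12 < n) :
    Runs hashProg s (800 * timeUnit n t ^ 3) fun s' =>
      s'.reg 13 = rank (s.reg 11) (slot (fineCells t) (digit (sigWidth t) (s.reg 9))
        (digit 2 (s.reg 10)) (cellHash n (fineCells t) (s.reg 7) (s.reg 12)) (levels t)) ∧
      Frame 13 s s' := by
  obtain ⟨r0, r1, r2, r3, r4, r5, r6⟩ := hs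
  set U := timeUnit n t with hU
  have hn : 1 ≤ n := by omega
  obtain ⟨hU1, hVU, hnU, hNn, hNU⟩ := timeUnit_bounds ht hn
  rw [← hU] at hU1 hVU hnU hNn hNU
  have hsw := sigWidth_le_seeds ht
  have hb := mul_blocks_le_seeds ht
  have hfp := fineCells_pos ht
  have hU13 : U ≤ U ^ 3 := Nat.le_self_pow (by norm_num) U
  have hU23 : U ^ 2 ≤ U ^ 3 := Nat.pow_le_pow_right hU1 (by norm_num)
  have hmul : s.reg 7 * s.reg 12 ≤ U := (Nat.mul_le_mul ha.le hj.le).trans hNn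
  refine Runs.mono (T := 100 * U + (500 * U ^ 3 + (60 * U ^ 2 + 2))) ?_ (by omega) (fun _ h => h)
  refine Runs.seq ((runs_mulModDiv (k := 16) (a := 7) (j := 12) (N := 5) (n := 0) (U := U)
    (by omega) (by omega) (by omega) (by omega) (by rw [r5]; positivity) (by omega)
    (by omega) hmul hU1).mono le_rfl ?_)
  rintro s₂ ⟨c16, f2⟩
  have hu : s₂.reg 16 = cellHash n (fineCells t) (s.reg 7) (s.reg 12) := by
    rw [c16, r5, r0, cellHash]
  have hul := cellHash_lt hn hfp (s.reg 7) (s.reg 12)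
  have g2 := f2.1 2 (by omega)
  have g3 := f2.1 3 (by omega)
  have g4 := f2.1 4 (by omega)
  have g9 := f2.1 9 (by omega)
  have g10 := f2.1 10 (by omega)
  have g11 := f2.1 11 (by omega)
  have hfs := fineCells_le_seeds ht
  refine Runs.seq ((runs_slotProg (k := 17) (u := 16) (U := U) (by omega) (by omega)
    (by omega) (by rw [g4, r4]; exact sigWidth_pos ht) (by omega) (by omega) (by omega)
    (by omega) ?_ hU1).mono le_rfl ?_)
  · rw [g4, r4, hu]
    exact (Nat.mul_le_mul_left _ hul.le).trans ((sigWidth_mul_fineCells_le t).trans hVU)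
  rintro s₃ ⟨d17, f3⟩
  have f3' := f2.trans (f3.mono (show 16 ≤ 17 by omega))
  have k11 := f3'.1 11 (by omega)
  rw [g2, r2, g4, r4, g9, g10, g3, r3, hu] at d17
  have hsl : s₃.reg 17 < 2 ^ levels t := by
    rw [d17]; exact slot_lt hfp _ _ _ _
  have hlv := two_pow_levels_lt ht
  refine Runs.seq ((runs_scan (k := 18) (x := 11) (p := 17) (U := U) (by omega) (by omega)
    (by omega) (by omega) hU1).mono le_rfl ?_)
  rintro s₄ ⟨h18, -, -, f4⟩
  refine Runs.assign ⟨?_, ((f3'.trans (f4.mono (show 16 ≤ 18 by omega))).mono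
    (show 13 ≤ 16 by omega)).update le_rfl⟩
  simp only [State.set_reg, Function.update_self, Expr.eval]
  rw [h18, k11, d17]
  rfl

/-- Computes `FracHash.value` in register `13`. -/
def valueProg : Prog :=
  .ite (.sub (.reg 3) (.reg 8))
    (.seq (divMod 14 12 3) <|
      .ite (.add (.sub (.reg 15) (.reg 8)) (.sub (.reg 8) (.reg 15)))
        hashProg
        (.seq (divMod 16 7 4) <|
          .ite (.add (.sub (.reg 14) (.reg 16)) (.sub (.reg 16) (.reg 14)))
            (.assign 13 (.const 0)) (.assign 13 (.const 1))))
    (.seq (bit 14 10 12) <| .assign 13 (.reg 14))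

theorem runs_valueProg {n t : ℕ} (ht : 1 ≤ t) {s : State} (hs : Ready n t s)
    (ha : s.reg 7 < n * fineCells t) (hX : s.reg 9 < seeds t)
    (hY : s.reg 10 < seeds t) (hZ : s.reg 11 < seeds t) (hj : s.reg 12 < n) :
    Runs valueProg s (1000 * timeUnit n t ^ 3) fun s' =>
      s'.reg 13 = value n t (s.reg 7) (s.reg 8) (s.reg 9) (s.reg 10) (s.reg 11) (s.reg 12) ∧
      Frame 13 s s' := by
  obtain ⟨r0, r1, r2, r3, r4, r5, r6⟩ := hs
  set U := timeUnit n t with hU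
  have hn : 1 ≤ n := by omega
  obtain ⟨hU1, hVU, hnU, hNn, hNU⟩ := timeUnit_bounds ht hn
  rw [← hU] at hU1 hVU hnU hNn hNU
  have hsw := sigWidth_le_seeds ht
  have hb := mul_blocks_le_seeds ht
  have hfp := fineCells_pos ht
  have hU13 : U ≤ U ^ 3 := Nat.le_self_pow (by norm_num) U
  have hU23 : U ^ 2 ≤ U ^ 3 := Nat.pow_le_pow_right hU1 (by norm_num)
  have hbp : 0 < blocks t := by unfold blocks; omega
  refine Runs.mono (T := 3 + 1 + (30 * U + (7 + 1 + 800 * U ^ 3) +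
    100 * U ^ 2 + 30 * U)) ?_ (by omega) (fun _ h => h)
  refine Runs.ite (fun h => ?_) (fun h => ?_)
  · have hr : s.reg 8 < blocks t := by simp only [Expr.eval] at h; omega
    refine Runs.mono (T := 30 * U + (7 + 1 + 800 * U ^ 3)) ?_ (by omega) (fun _ h => h)
    refine Runs.seq ((runs_divMod (k := 14) (x := 12) (d := 3) (U := U) (by omega) (by omega)
      (by omega) (by omega) hU1).mono le_rfl ?_)
    rintro s₁ ⟨b14, b15, f1⟩
    rw [r3] at b14 b15
    replace b15 : s₁.reg 15 = _ := b15
    have e4 := f1.1 4 (by omega)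
    have e7 := f1.1 7 (by omega)
    have e8 := f1.1 8 (by omega)
    have e9 := f1.1 9 (by omega)
    have e10 := f1.1 10 (by omega)
    have e11 := f1.1 11 (by omega)
    have e12 := f1.1 12 (by omega)
    refine Runs.ite (fun h' => ?_) (fun h' => ?_)
    · have hne : ¬ s.reg 12 % blocks t = s.reg 8 := by
        simp only [Expr.eval] at h'; omega
      refine (runs_hashProg ht (Ready.congr ⟨r0, r1, r2, r3, r4, r5, r6⟩
        fun q hq => f1.1 q (by omega)) (by omega) (by omega) (by omega) (by omega)
        (by omega)).mono le_rfl ?_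
      rintro s₂ ⟨h13, f2⟩
      refine ⟨?_, (f1.mono (by omega)).trans f2⟩
      rw [h13, e7, e9, e10, e11, e12, value, if_pos hr, if_neg hne]
    · have he : s.reg 12 % blocks t = s.reg 8 := by
        simp only [Expr.eval] at h'; omega
      refine Runs.mono (T := 30 * U + (7 + 1 + 2)) ?_ (by omega) (fun _ h => h)
      refine Runs.seq ((runs_divMod (k := 16) (x := 7) (d := 4) (U := U) (by omega) (by omega)
        (by rw [e4, r4]; exact sigWidth_pos ht) (by omega) hU1).mono le_rfl ?_)
      rintro s₂ ⟨c16, -, f2⟩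
      have f2' := f1.trans (f2.mono (show 14 ≤ 16 by omega))
      have g14 := f2.1 14 (by omega)
      rw [e7, e4, r4] at c16
      refine Runs.ite
        (fun h'' => Runs.assign ⟨?_, (f2'.mono (show 13 ≤ 14 by omega)).update le_rfl⟩)
        (fun h'' => Runs.assign ⟨?_, (f2'.mono (show 13 ≤ 14 by omega)).update le_rfl⟩)
      · have hne : ¬ s.reg 12 / blocks t = s.reg 7 / sigWidth t := by
          simp only [Expr.eval] at h''; omega
        simp only [State.set_reg, Function.update_self, Expr.eval]
        rw [value, if_pos hr, if_pos he, if_neg hne]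
      · have hne : s.reg 12 / blocks t = s.reg 7 / sigWidth t := by
          simp only [Expr.eval] at h''; omega
        simp only [State.set_reg, Function.update_self, Expr.eval]
        rw [value, if_pos hr, if_pos he, if_pos hne]
  · have hr : ¬ s.reg 8 < blocks t := by simp only [Expr.eval] at h; omega
    refine Runs.mono (T := 100 * U ^ 2 + 2) ?_ (by omega) (fun _ h => h)
    refine Runs.seq ((runs_bit (k := 14) (x := 10) (p := 12) (U := U) (by omega) (by omega)
      (by omega) (by omega) hU1).mono le_rfl ?_)
    rintro s₁ ⟨b14, f1⟩
    refine Runs.assign ⟨?_, (f1.mono (show 13 ≤ 14 by omega)).update le_rfl⟩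
    simp only [State.set_reg, Function.update_self, Expr.eval]
    rw [b14, value, if_neg hr, digit]

/-- The registers below `k` are unchanged and the list `l` has been written. -/
def Emits (k : ℕ) (l : List ℕ) (s s' : State) : Prop :=
  (∀ r < k, s'.reg r = s.reg r) ∧ s'.out = s.out ++ l

/-- Runs `p` for each value of register `c` below the value of register `b`. -/
def loop (c b : ℕ) (p : Prog) : Prog :=
  .seq (.assign c (.const 0)) <|
  .while (.sub (.reg b) (.reg c)) <|
  .seq p (.assign c (.add (.reg c) (.const 1)))

theorem runs_loop {c b C e U : ℕ} {p : Prog} (hb : b < c) {s : State} (hbU : s.reg b ≤ U)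
    (hU1 : 1 ≤ U) (F : ℕ → List ℕ)
    (hp : ∀ i < s.reg b, ∀ s', (∀ r < c, s'.reg r = s.reg r) → s'.reg c = i →
      Runs p s' (C * U ^ e) (Emits (c + 1) (F i) s')) :
    Runs (loop c b p) s ((C + 20) * U ^ (e + 1))
      (Emits c ((List.range (s.reg b)).flatMap F) s) := by
  refine Runs.mono (T := 2 + (s.reg b * (4 + (C * U ^ e + 4)) + 4)) ?_ ?_ (fun _ h => h)
  swap
  · have h1 := Nat.mul_le_mul_right (4 + (C * U ^ e + 4)) hbU
    have h2 : U ≤ U ^ (e + 1) := Nat.le_self_pow (by omega) U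
    have h3 : U * (4 + (C * U ^ e + 4)) = 8 * U + C * U ^ (e + 1) := by ring
    nlinarith
  refine Runs.seq (Runs.assign ?_)
  refine Runs.while (fun i s' => s'.reg c = i ∧ Emits c ((List.range i).flatMap F) s s') _ ?_ ?_ ?_
  · rintro i hi s' ⟨h1, h2, h3⟩
    have := h2 b hb
    refine ⟨by simp only [Expr.eval]; omega, ?_⟩
    refine Runs.seq ((hp i hi s' h2 h1).mono le_rfl ?_)
    rintro s₁ ⟨g1, g2⟩
    refine Runs.assign ⟨?_, fun r hr => ?_, ?_⟩
    · simp [Expr.eval, g1 c (by omega), h1]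
    · simp [Function.update_of_ne hr.ne, g1 r (by omega), h2 r hr]
    · simp [g2, h3, List.range_succ]
  · rintro s' ⟨h1, h2, h3⟩
    exact ⟨by simp only [Expr.eval]; have := h2 b hb; omega, h2, h3⟩
  · refine ⟨by simp [Expr.eval], fun r hr => by simp [Function.update_of_ne hr.ne], by simp⟩

/-- The expression `2 ^ i * e`. -/
def Expr.twice : ℕ → Expr → Expr
  | 0, e => e
  | i + 1, e => (Expr.twice i e).add (Expr.twice i e)

@[simp] theorem Expr.eval_twice (s : State) (i : ℕ) (e : Expr) :
    (Expr.twice i e).eval s = 2 ^ i * e.eval s := by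
  induction i with
  | zero => simp [Expr.twice]
  | succ i ih => simp only [Expr.twice, Expr.eval, ih]; ring

theorem Expr.cost_twice (i : ℕ) (e : Expr) : (Expr.twice i e).cost + 1 = 2 ^ i * (e.cost + 1) := by
  induction i with
  | zero => simp [Expr.twice]
  | succ i ih =>
    have : (Expr.twice (i + 1) e).cost + 1 =
      ((Expr.twice i e).cost + 1) + ((Expr.twice i e).cost + 1) := by
      simp only [Expr.twice, Expr.cost]; ring
    rw [this, ih]; ring

/-- Computes the constants of the enumeration. -/
def setup : Prog :=
  .seq (mul 2 1 1) <|
  .seq (.assign 2 (Expr.twice 10 (.reg 2))) <|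
  .seq (.assign 3 (Expr.twice 6 (.reg 1))) <|
  .seq (mul 4 2 3) <|
  .seq (mul 5 0 2) <|
  .seq (.assign 7 (Expr.twice 8 (.reg 1))) <|
  .seq (.assign 6 (.const 1)) <|
  .while (.reg 7) <|
    .seq (.assign 6 (.add (.reg 6) (.reg 6)))
      (.assign 7 (.sub (.reg 7) (.const 1)))

theorem runs_setup {n t : ℕ} (ht : 1 ≤ t) (hn : 1 ≤ n) :
    Runs setup (init n t) (6000 * timeUnit n t) fun s' => Ready n t s' ∧ s'.out = [] := by
  set U := timeUnit n t with hU
  obtain ⟨hU1, hVU, hnU, hNn, hNU⟩ := timeUnit_bounds ht hn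
  rw [← hU] at hU1 hVU hnU hNn hNU
  have hf := fineCells_le_seeds ht
  have hb := mul_blocks_le_seeds ht
  have hbt : blocks t = 64 * t := rfl
  have c10 : (Expr.twice 10 (.reg 2)).cost + 1 = 2 ^ 10 * 2 := Expr.cost_twice _ _
  have c6 : (Expr.twice 6 (.reg 1)).cost + 1 = 2 ^ 6 * 2 := Expr.cost_twice _ _
  have c8 : (Expr.twice 8 (.reg 1)).cost + 1 = 2 ^ 8 * 2 := Expr.cost_twice _ _
  refine Runs.mono (T := 30 * U + (((Expr.twice 10 (.reg 2)).cost + 1) +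
    (((Expr.twice 6 (.reg 1)).cost + 1) + (30 * U + (30 * U +
    (((Expr.twice 8 (.reg 1)).cost + 1) + (2 + (256 * t * (2 + (4 + 4)) + 2)))))))) ?_
    (by rw [c10, c6, c8]; norm_num; omega) (fun _ h => h)
  have i0 : (init n t).reg 0 = n := rfl
  have i1 : (init n t).reg 1 = t := rfl
  refine Runs.seq ((runs_mul (k := 2) (x := 1) (y := 1) (U := U) (by omega) (by omega)
    (by omega) hU1).mono le_rfl ?_)
  rintro s₁ ⟨a2, f1⟩
  have b0 := f1.1 0 (by omega)
  have b1 := f1.1 1 (by omega)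
  refine Runs.seq (Runs.assign (Runs.seq (Runs.assign ?_)))
  set s₂ := (s₁.set 2 ((Expr.twice 10 (.reg 2)).eval s₁)) with hs2
  set s₃ := s₂.set 3 ((Expr.twice 6 (.reg 1)).eval s₂) with hs3
  have d0 : s₃.reg 0 = n := by simp [hs3, hs2, b0, i0]
  have d1 : s₃.reg 1 = t := by simp [hs3, hs2, b1, i1]
  have d2 : s₃.reg 2 = fineCells t := by
    simp [hs3, hs2, Expr.eval, a2, i1, fineCells]
  have d3 : s₃.reg 3 = blocks t := by
    simp [hs3, hs2, Expr.eval, b1, i1, blocks]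
  have dout : s₃.out = [] := by simp only [hs3, hs2, State.set_out, f1.2]; rfl
  refine Runs.seq ((runs_mul (k := 4) (x := 2) (y := 3) (U := U) (by omega) (by omega)
    (by omega) hU1).mono le_rfl ?_)
  rintro s₄ ⟨e4, f4⟩
  refine Runs.seq ((runs_mul (k := 5) (x := 0) (y := 2) (U := U) (by omega) (by omega)
    (by rw [f4.1 2 (by omega)]; omega) hU1).mono le_rfl ?_)
  rintro s₅ ⟨e5, f5⟩
  rw [f4.1 0 (by omega), f4.1 2 (by omega), d0, d2] at e5
  rw [d2, d3] at e4
  have g0 : s₅.reg 0 = n := by rw [f5.1 0 (by omega), f4.1 0 (by omega), d0]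
  have g1 : s₅.reg 1 = t := by rw [f5.1 1 (by omega), f4.1 1 (by omega), d1]
  have g2 : s₅.reg 2 = fineCells t := by rw [f5.1 2 (by omega), f4.1 2 (by omega), d2]
  have g3 : s₅.reg 3 = blocks t := by rw [f5.1 3 (by omega), f4.1 3 (by omega), d3]
  have g4 : s₅.reg 4 = sigWidth t := by rw [f5.1 4 (by omega), e4]; rfl
  have gout : s₅.out = [] := by rw [f5.2, f4.2, dout]
  refine Runs.seq (Runs.assign (Runs.seq (Runs.assign ?_)))
  refine Runs.while (T := 8) (fun i s' => Frame 6 s₅ s' ∧ s'.reg 6 = 2 ^ i ∧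
    s'.reg 7 = 256 * t - i) _ ?_ ?_ ?_
  · rintro i hi s' ⟨h1, h2, h3⟩
    refine ⟨by simp only [Expr.eval]; omega, ?_⟩
    refine Runs.seq (T := 4) (T' := 4) (Runs.assign (Runs.assign ⟨?_, ?_, ?_⟩))
    · exact (h1.update le_rfl).update (by omega)
    · simp [Expr.eval, h2, pow_succ, mul_two]
    · simp [Expr.eval, h3]; omega
  · rintro s' ⟨h1, h2, h3⟩
    refine ⟨by simp only [Expr.eval]; omega, ⟨?_, ?_, ?_, ?_, ?_, ?_, h2⟩, h1.2.trans gout⟩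
    · rw [h1.1 0 (by omega), g0]
    · rw [h1.1 1 (by omega), g1]
    · rw [h1.1 2 (by omega), g2]
    · rw [h1.1 3 (by omega), g3]
    · rw [h1.1 4 (by omega), g4]
    · rw [h1.1 5 (by omega), e5]
  · exact ⟨((Frame.refl _ _).update (by omega)).update le_rfl, by simp [Expr.eval],
      by simp [Expr.eval, g1]⟩

/-- Writes the table of values of the map with the current parameters. -/
def table : Prog :=
  loop 12 0 <| .seq valueProg <|
    .emit (.sub (.sub (.reg 1) (.const 1)) (.sub (.sub (.reg 1) (.const 1)) (.reg 13)))

/-- Lists the tables of all members of the family. -/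
def mainProg : Prog :=
  .seq setup <| loop 7 5 <| loop 8 6 <| loop 9 6 <| loop 10 6 <| loop 11 6 table

theorem runs_mainProg {n t : ℕ} (ht : 1 ≤ t) (hn : 1 ≤ n) :
    Runs mainProg (init n t) (8000 * timeUnit n t ^ 9) fun s' => s'.out =
      (List.range (n * fineCells t)).flatMap fun a => (List.range (seeds t)).flatMap fun r =>
      (List.range (seeds t)).flatMap fun X => (List.range (seeds t)).flatMap fun Y =>
      (List.range (seeds t)).flatMap fun Z => (List.range n).flatMap fun j =>
        [min (value n t a r X Y Z j) (t - 1)] := by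
  set U := timeUnit n t with hU
  obtain ⟨hU1, hVU, hnU, hNn, hNU⟩ := timeUnit_bounds ht hn
  rw [← hU] at hU1 hVU hnU hNn hNU
  have hU9 : U ≤ U ^ 9 := Nat.le_self_pow (by norm_num) U
  have hU3 : 1 ≤ U ^ 3 := Nat.one_le_pow _ _ hU1
  refine Runs.mono (T := 6000 * U + (1020 + 20 + 20 + 20 + 20 + 20 + 20) *
    U ^ (3 + 1 + 1 + 1 + 1 + 1 + 1)) ?_ (by norm_num; omega) (fun _ h => h)
  refine Runs.seq ((runs_setup ht hn).mono le_rfl ?_)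
  rintro s ⟨hs, hout⟩
  have h5 := hs.2.2.2.2.2.1
  have key : ∀ s' : State, (∀ r < 7, s'.reg r = s.reg r) → Ready n t s' := fun s' h => hs.congr h
  refine Runs.mono (Q := Emits 7 ((List.range (s.reg 5)).flatMap fun a =>
      (List.range (seeds t)).flatMap fun r => (List.range (seeds t)).flatMap fun X =>
      (List.range (seeds t)).flatMap fun Y => (List.range (seeds t)).flatMap fun Z =>
      (List.range n).flatMap fun j => [min (value n t a r X Y Z j) (t - 1)]) s)
    (runs_loop (c := 7) (b := 5) (C := 1020 + 20 + 20 + 20 + 20 + 20)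
    (e := 3 + 1 + 1 + 1 + 1 + 1) (U := U) (by omega) (by omega) hU1 _ ?_) le_rfl ?_
  swap
  · rintro s' ⟨-, h⟩
    rw [h, hout, h5, List.nil_append]
  intro a ha s7 e7 r7
  rw [h5] at ha
  have R7 := key s7 e7
  rw [← R7.2.2.2.2.2.2]
  refine runs_loop (c := 8) (b := 6) (by omega) (by rw [R7.2.2.2.2.2.2]; exact hVU) hU1 _ ?_
  intro r _ s8 e8 r8
  have R8 := R7.congr (fun q hq => e8 q (by omega))
  rw [R7.2.2.2.2.2.2, ← R8.2.2.2.2.2.2]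
  refine runs_loop (c := 9) (b := 6) (by omega) (by rw [R8.2.2.2.2.2.2]; exact hVU) hU1 _ ?_
  intro X hX s9 e9 r9
  have R9 := R8.congr (fun q hq => e9 q (by omega))
  rw [R8.2.2.2.2.2.2] at hX ⊢
  rw [← R9.2.2.2.2.2.2]
  refine runs_loop (c := 10) (b := 6) (by omega) (by rw [R9.2.2.2.2.2.2]; exact hVU) hU1 _ ?_
  intro Y hY s10 e10 r10
  have R10 := R9.congr (fun q hq => e10 q (by omega))
  rw [R9.2.2.2.2.2.2] at hY ⊢
  rw [← R10.2.2.2.2.2.2]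
  refine runs_loop (c := 11) (b := 6) (by omega) (by rw [R10.2.2.2.2.2.2]; exact hVU) hU1 _ ?_
  intro Z hZ s11 e11 r11
  have R11 := R10.congr (fun q hq => e11 q (by omega))
  rw [R10.2.2.2.2.2.2] at hZ
  have hn0 := R11.1
  have : ∀ F : ℕ → List ℕ, (List.range n).flatMap F = (List.range (s11.reg 0)).flatMap F := by
    rw [hn0]; exact fun _ => rfl
  rw [this]
  refine runs_loop (c := 12) (b := 0) (by omega) (by omega) hU1 _ ?_
  intro j hj s12 e12 r12
  rw [hn0] at hj
  have R12 := R11.congr (fun q hq => e12 q (by omega))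
  have v7 : s12.reg 7 = a := by
    rw [e12 7 (by omega), e11 7 (by omega), e10 7 (by omega), e9 7 (by omega), e8 7 (by omega), r7]
  have v8 : s12.reg 8 = r := by
    rw [e12 8 (by omega), e11 8 (by omega), e10 8 (by omega), e9 8 (by omega), r8]
  have v9 : s12.reg 9 = X := by
    rw [e12 9 (by omega), e11 9 (by omega), e10 9 (by omega), r9]
  have v10 : s12.reg 10 = Y := by rw [e12 10 (by omega), e11 10 (by omega), r10]
  have v11 : s12.reg 11 = Z := by rw [e12 11 (by omega), r11]
  refine Runs.mono (T := 1000 * U ^ 3 + 20) ?_ (by nlinarith) (fun _ h => h)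
  refine Runs.seq ((runs_valueProg ht R12 (by omega) (by omega) (by omega) (by omega)
    (by omega)).mono le_rfl ?_)
  rintro s13 ⟨w, f⟩
  refine Runs.mono (Runs.emit ⟨f.1, ?_⟩) (by norm_num [Expr.cost]) (fun _ h => h)
  have := f.1 1 (by omega)
  have ht1 := R12.2.1
  simp only [Expr.eval, f.2, w, v7, v8, v9, v10, v11, r12, this, ht1]
  congr 2
  omega

end RAM

namespace FracHash

/-! ### Collisions of the multiplicative hash functions -/

/-- As `a` runs through `[0, N)`, the multiple `a * d` winds `d` times around the residues modulo
`N`, and each time at most `n / d + 1` of the values fall into a given interval of length `n`. -/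
theorem card_mul_mod_mem_interval_le (N s : ℕ) {n d : ℕ} (hd : 0 < d) (hdn : d < n) :
    ((Finset.range N).filter fun a => s ≤ a * d % N ∧ a * d % N < s + n).card ≤ 2 * n := by
  have hcard : (Finset.range d ×ˢ Finset.range (n / d + 1)).card ≤ 2 * n := by
    have := Nat.mul_div_le n d
    rw [Finset.card_product, Finset.card_range, Finset.card_range, mul_add]
    omega
  refine le_trans (Finset.card_le_card_of_injOn
    (fun a => (a * d / N, (a * d % N - s) / d)) ?_ ?_) hcard
  · intro a ha
    simp only [Finset.coe_filter, Finset.mem_range, Set.mem_ofPred_eq] at ha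
    obtain ⟨haN, h1, h2⟩ := ha
    simp only [Finset.coe_product, Set.mem_prod, Finset.coe_range, Set.mem_Iio]
    refine ⟨Nat.div_lt_of_lt_mul (Nat.mul_lt_mul_of_pos_right haN hd), ?_⟩
    have : (a * d % N - s) / d ≤ n / d := Nat.div_le_div_right (by omega)
    omega
  · intro a ha b hb hab
    simp only [Finset.coe_filter, Finset.mem_range, Set.mem_ofPred_eq] at ha hb
    simp only [Prod.mk.injEq] at hab
    obtain ⟨hq, hv⟩ := hab
    have ea := Nat.div_add_mod (a * d) N
    have eb := Nat.div_add_mod (b * d) N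
    rw [hq] at ea
    have va := Nat.div_add_mod (a * d % N - s) d
    have vb := Nat.div_add_mod (b * d % N - s) d
    have la := Nat.mod_lt (a * d % N - s) hd
    have lb := Nat.mod_lt (b * d % N - s) hd
    rw [hv] at va
    have h1 : a * d < (b + 1) * d := by rw [Nat.succ_mul]; omega
    have h2 : b * d < (a + 1) * d := by rw [Nat.succ_mul]; omega
    have h3 := Nat.lt_of_mul_lt_mul_right h1
    have h4 := Nat.lt_of_mul_lt_mul_right h2
    omega

theorem card_cellHash_eq_le {n m : ℕ} {j k : ℕ} (hjk : k ≠ j) (hj : j < n) (hk : k < n) :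
    ((Finset.range (n * m)).filter fun a => cellHash n m a k = cellHash n m a j).card ≤
      4 * n := by
  wlog hlt : j < k generalizing j k
  · have := this hjk.symm hk hj (by omega)
    simpa only [eq_comm] using this
  have hn : 0 < n := by omega
  have key : ((Finset.range (n * m)).filter fun a => cellHash n m a k = cellHash n m a j) ⊆
      ((Finset.range (n * m)).filter fun a => 0 ≤ a * (k - j) % (n * m) ∧
        a * (k - j) % (n * m) < 0 + n) ∪
      ((Finset.range (n * m)).filter fun a => n * m - n ≤ a * (k - j) % (n * m) ∧
        a * (k - j) % (n * m) < n * m - n + n) := by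
    intro a ha
    obtain ⟨haN, he⟩ := Finset.mem_filter.1 ha
    rw [Finset.mem_range] at haN
    simp only [Finset.mem_filter, Finset.mem_range, Finset.mem_union]
    unfold cellHash at he
    have hN : 0 < n * m := by omega
    have hadd : a * k = a * j + a * (k - j) := by rw [← mul_add]; congr 1; omega
    have hmod : (a * j % (n * m) + a * (k - j) % (n * m)) % (n * m) = a * k % (n * m) := by
      rw [hadd]; exact (Nat.add_mod _ _ _).symm
    set x := a * j % (n * m)
    set y := a * k % (n * m)
    set v := a * (k - j) % (n * m) with hv
    have hx : x < n * m := Nat.mod_lt _ hN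
    have hvl : v < n * m := Nat.mod_lt _ hN
    have ex := Nat.div_add_mod x n
    have ey := Nat.div_add_mod y n
    have lx := Nat.mod_lt x hn
    have ly := Nat.mod_lt y hn
    rw [he] at ey
    have hcase : x + v = y ∨ x + v = y + n * m := by
      rcases lt_or_ge (x + v) (n * m) with h | h
      · left; rwa [Nat.mod_eq_of_lt h] at hmod
      · right
        rw [Nat.mod_eq_sub_mod h, Nat.mod_eq_of_lt (by omega)] at hmod
        omega
    rcases hcase with h | h
    · left; exact ⟨haN, by omega, by omega⟩
    · right; exact ⟨haN, by omega, by omega⟩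
  have h1 := card_mul_mod_mem_interval_le (n * m) 0 (n := n) (d := k - j) (by omega) (by omega)
  have h2 := card_mul_mod_mem_interval_le (n * m) (n * m - n) (n := n) (d := k - j) (by omega)
    (by omega)
  have h3 := (Finset.card_le_card key).trans (Finset.card_union_le _ _)
  omega

/-! ### Loads and collision weight -/

/-- The weight of the part of `s` that `f` maps to `b`. -/
noncomputable def load (s : Finset ℕ) (w : ℕ → ℝ) (f : ℕ → ℕ) (b : ℕ) : ℝ :=
  ∑ j ∈ s with f j = b, w j

/-- The sum of `w j * w k` over all ordered pairs of distinct `j`, `k` in `s` with `f j = f k`; see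
`collisions_eq`. -/
noncomputable def collisions (s : Finset ℕ) (w : ℕ → ℝ) (f : ℕ → ℕ) : ℝ :=
  ∑ j ∈ s, w j * (load s w f (f j) - w j)

section Loads

variable {s : Finset ℕ} {w : ℕ → ℝ} {f : ℕ → ℕ}

theorem collisions_eq (s : Finset ℕ) (w : ℕ → ℝ) (f : ℕ → ℕ) :
    collisions s w f = ∑ j ∈ s, ∑ k ∈ s, if k ≠ j ∧ f k = f j then w j * w k else 0 := by
  refine Finset.sum_congr rfl fun j hj => ?_
  have h1 : load s w f (f j) = w j + ∑ k ∈ s, if k ≠ j ∧ f k = f j then w k else 0 := by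
    rw [load, Finset.sum_filter, ← Finset.add_sum_erase s _ hj, if_pos rfl,
      ← Finset.add_sum_erase s (fun k => if k ≠ j ∧ f k = f j then w k else 0) hj]
    simp only [ne_eq, not_true_eq_false, false_and, if_false, zero_add]
    congr 1
    refine Finset.sum_congr rfl fun k hk => ?_
    simp [Finset.ne_of_mem_erase hk]
  rw [h1, add_sub_cancel_left, Finset.mul_sum]
  refine Finset.sum_congr rfl fun k _ => ?_
  split_ifs <;> simp

theorem le_load (hw : ∀ j ∈ s, 0 ≤ w j) {j : ℕ} (hj : j ∈ s) : w j ≤ load s w f (f j) :=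
  Finset.single_le_sum (f := w) (fun k hk => hw k (Finset.mem_filter.1 hk).1)
    (Finset.mem_filter.2 ⟨hj, rfl⟩)

theorem load_nonneg (hw : ∀ j ∈ s, 0 ≤ w j) (b : ℕ) : 0 ≤ load s w f b :=
  Finset.sum_nonneg fun k hk => hw k (Finset.mem_filter.1 hk).1

/-- A cell whose load exceeds the single weights causes collisions quadratic in its load. -/
theorem load_mul_sub_le_collisions {μ : ℝ} (hw : ∀ j ∈ s, 0 ≤ w j) (hμ : ∀ j ∈ s, w j ≤ μ)
    (b : ℕ) : load s w f b * (load s w f b - μ) ≤ collisions s w f := by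
  calc load s w f b * (load s w f b - μ)
      = ∑ j ∈ s with f j = b, w j * (load s w f b - μ) := by rw [← Finset.sum_mul]; rfl
    _ ≤ ∑ j ∈ s with f j = b, w j * (load s w f (f j) - w j) := by
        refine Finset.sum_le_sum fun j hj => ?_
        obtain ⟨hjs, rfl⟩ := Finset.mem_filter.1 hj
        exact mul_le_mul_of_nonneg_left (by linarith [hμ j hjs]) (hw j hjs)
    _ ≤ collisions s w f :=
        Finset.sum_le_sum_of_subset_of_nonneg (Finset.filter_subset _ _) fun j hj _ =>
          mul_nonneg (hw j hj) (sub_nonneg.2 (le_load hw hj))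

/-- The total weight in overloaded cells is controlled by the collision weight. -/
theorem heavy_weight_mul_le_collisions {μ θ : ℝ} (hw : ∀ j ∈ s, 0 ≤ w j)
    (hμ : ∀ j ∈ s, w j ≤ μ) :
    (∑ j ∈ s with θ < load s w f (f j), w j) * (θ - μ) ≤ collisions s w f := by
  rw [Finset.sum_mul]
  calc ∑ j ∈ s with θ < load s w f (f j), w j * (θ - μ)
      ≤ ∑ j ∈ s with θ < load s w f (f j), w j * (load s w f (f j) - w j) := by
        refine Finset.sum_le_sum fun j hj => ?_
        obtain ⟨hj, h⟩ := Finset.mem_filter.1 hj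
        exact mul_le_mul_of_nonneg_left (by linarith [hμ j hj]) (hw j hj)
    _ ≤ collisions s w f :=
        Finset.sum_le_sum_of_subset_of_nonneg (Finset.filter_subset _ _) fun j hj _ =>
          mul_nonneg (hw j hj) (sub_nonneg.2 (le_load hw hj))

theorem sum_collisions_cellHash_le {n m : ℕ} (hs : s ⊆ Finset.range n) (hw : ∀ j ∈ s, 0 ≤ w j) :
    ∑ a ∈ Finset.range (n * m), collisions s w (cellHash n m a) ≤ 4 * n * (∑ j ∈ s, w j) ^ 2 := by
  simp only [collisions_eq]
  rw [Finset.sum_comm, sq, Finset.sum_mul_sum, Finset.mul_sum]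
  refine Finset.sum_le_sum fun j hj => ?_
  rw [Finset.sum_comm, Finset.mul_sum]
  refine Finset.sum_le_sum fun k hk => ?_
  have hwjk : 0 ≤ w j * w k := mul_nonneg (hw j hj) (hw k hk)
  by_cases hkj : k = j
  · simp only [hkj, ne_eq, not_true_eq_false, false_and, if_false, Finset.sum_const_zero]
    subst hkj; positivity
  simp only [ne_eq, hkj, not_false_eq_true, true_and]
  rw [← Finset.sum_filter, Finset.sum_const, nsmul_eq_mul]
  refine mul_le_mul_of_nonneg_right ?_ hwjk
  exact_mod_cast card_cellHash_eq_le hkj (Finset.mem_range.1 (hs hj)) (Finset.mem_range.1 (hs hk))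

theorem exists_collisions_cellHash_le {n m : ℕ} (hn : 0 < n) (hm : 0 < m)
    (hs : s ⊆ Finset.range n) (hw : ∀ j ∈ s, 0 ≤ w j) :
    ∃ a < n * m, collisions s w (cellHash n m a) ≤ 4 * (∑ j ∈ s, w j) ^ 2 / m := by
  have hne : (Finset.range (n * m)).Nonempty := Finset.nonempty_range_iff.2 (by positivity)
  have hle : ∑ a ∈ Finset.range (n * m), collisions s w (cellHash n m a) ≤
      ∑ _a ∈ Finset.range (n * m), 4 * (∑ j ∈ s, w j) ^ 2 / m := by
    refine (sum_collisions_cellHash_le hs hw).trans (le_of_eq ?_)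
    rw [Finset.sum_const, Finset.card_range, nsmul_eq_mul]
    push_cast
    field_simp
  obtain ⟨a, ha, h⟩ := Finset.exists_le_of_sum_le hne hle
  exact ⟨a, Finset.mem_range.1 ha, h⟩

/-- By Markov's inequality, at least half of the multipliers cause few collisions. -/
theorem le_card_collisions_cellHash_le {n m : ℕ} {W : ℝ} (hm : 0 < m)
    (hs : s ⊆ Finset.range n) (hw : ∀ j ∈ s, 0 ≤ w j) (hW : ∑ j ∈ s, w j ≤ W) (hW0 : 0 < W) :
    n * m ≤ 2 * ((Finset.range (n * m)).filter fun a =>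
      collisions s w (cellHash n m a) ≤ 8 * W ^ 2 / m).card := by
  set bad := (Finset.range (n * m)).filter fun a =>
    ¬ collisions s w (cellHash n m a) ≤ 8 * W ^ 2 / m with hbad
  have hsplit := Finset.card_filter_add_card_filter_not (s := Finset.range (n * m))
    (fun a => collisions s w (cellHash n m a) ≤ 8 * W ^ 2 / m)
  rw [Finset.card_range, ← hbad] at hsplit
  have hnn : ∀ a, 0 ≤ collisions s w (cellHash n m a) := fun a =>
    Finset.sum_nonneg fun j hj => mul_nonneg (hw j hj) (sub_nonneg.2 (le_load hw hj))
  have hS0 : 0 ≤ ∑ j ∈ s, w j := Finset.sum_nonneg hw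
  have h1 : (bad.card : ℝ) * (8 * W ^ 2 / m) ≤ 4 * n * W ^ 2 := by
    calc (bad.card : ℝ) * (8 * W ^ 2 / m) = ∑ _a ∈ bad, 8 * W ^ 2 / (m : ℝ) := by simp
      _ ≤ ∑ a ∈ bad, collisions s w (cellHash n m a) :=
          Finset.sum_le_sum fun a ha => (not_le.1 (Finset.mem_filter.1 ha).2).le
      _ ≤ ∑ a ∈ Finset.range (n * m), collisions s w (cellHash n m a) :=
          Finset.sum_le_sum_of_subset_of_nonneg (Finset.filter_subset _ _) fun a _ _ => hnn a
      _ ≤ 4 * n * (∑ j ∈ s, w j) ^ 2 := sum_collisions_cellHash_le hs hw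
      _ ≤ 4 * n * W ^ 2 := by gcongr
  have h2 : 2 * (bad.card : ℝ) ≤ n * m := by
    have hm' : (0 : ℝ) < m := by exact_mod_cast hm
    rw [← mul_div_assoc, div_le_iff₀ hm'] at h1
    have h3 : (0 : ℝ) < 4 * W ^ 2 := by positivity
    refine le_of_mul_le_mul_right ?_ h3
    nlinarith
  have h3 : 2 * bad.card ≤ n * m := by exact_mod_cast h2
  omega

end Loads

/-! ### The levels -/

theorem slot_congr {m : ℕ} (hm : 0 < m) {α α' β β' : ℕ → ℕ} (u : ℕ) {i : ℕ}
    (hα : ∀ k < i, α k = α' k) (hβ : ∀ c < 2 ^ i, β c = β' c) :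
    slot m α β u i = slot m α' β' u i := by
  induction i with
  | zero => rfl
  | succ i ih =>
    have h1 := cellHash_lt hm (show 0 < 2 ^ i by positivity) (α' i) u
    rw [slot, slot, ih (fun k hk => hα k (by omega))
      (fun c hc => hβ c (by rw [pow_succ]; omega)), hα i (by omega),
      hβ _ (by rw [pow_succ]; omega)]

/-- Weights of at most `M / 5` can be spread over `2 ^ i` slots of load at most `3 / 5 * M` if their
sum is at most `M * 2 ^ i / 40`: some multiplier for the highest level causes so few collisions that
the weight in overloaded cells, which are closed, is at most half of the total. -/
theorem exists_slot_load_le {m : ℕ} (hm : 0 < m) {w : ℕ → ℝ} {M : ℝ} (hM : 0 < M)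
    (hw : ∀ u, 0 ≤ w u) (hw5 : ∀ u, w u ≤ M / 5) (i : ℕ) (s : Finset ℕ)
    (hs : s ⊆ Finset.range m) (hW : ∑ u ∈ s, w u ≤ M * 2 ^ i / 40) :
    ∃ α β : ℕ → ℕ, (∀ k, α k < m * 2 ^ k) ∧ (∀ c, β c < 2) ∧
      ∀ p, ∑ u ∈ s with slot m α β u i = p, w u ≤ 3 / 5 * M := by
  induction i generalizing s with
  | zero =>
    refine ⟨fun _ => 0, fun _ => 0, fun k => by positivity, fun _ => by norm_num, fun p => ?_⟩
    calc ∑ u ∈ s with slot m (fun _ => 0) (fun _ => 0) u 0 = p, w u ≤ ∑ u ∈ s, w u :=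
          Finset.sum_le_sum_of_subset_of_nonneg (Finset.filter_subset _ _) fun u _ _ => hw u
      _ ≤ 3 / 5 * M := by linarith
  | succ i ih =>
    obtain ⟨a, ha, hcol⟩ := exists_collisions_cellHash_le (m := 2 ^ i) hm (by positivity) hs
      (fun u _ => hw u)
    set f := cellHash m (2 ^ i) a with hf
    set s' := s.filter fun u => 3 / 5 * M < load s w f (f u) with hs'
    have hheavy : (∑ u ∈ s', w u) * (3 / 5 * M - M / 5) ≤ collisions s w f :=
      heavy_weight_mul_le_collisions (fun u _ => hw u) (fun u _ => hw5 u)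
    -- With `W` the total weight, the collision weight is at most `4 * W ^ 2 / 2 ^ i`, where
    -- `W ≤ M * 2 ^ i / 20`, and overloaded cells cause `2 / 5 * M` of it per unit of weight.
    have hW' : ∑ u ∈ s', w u ≤ M * 2 ^ i / 40 := by
      have h0 : 0 ≤ ∑ u ∈ s, w u := Finset.sum_nonneg fun u _ => hw u
      have h2 : (0 : ℝ) < 2 ^ i := by positivity
      have h3 := hheavy.trans hcol
      push_cast at h3
      rw [le_div_iff₀ h2] at h3
      have h4 : (∑ u ∈ s, w u) ^ 2 ≤ (M * 2 ^ i / 20) ^ 2 := by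
        refine pow_le_pow_left₀ h0 (hW.trans (le_of_eq ?_)) 2
        rw [pow_succ]; ring
      have h5 : (0 : ℝ) < 2 / 5 * M * 2 ^ i := by positivity
      refine le_of_mul_le_mul_right ?_ h5
      nlinarith
    obtain ⟨α, β, hα, hβ, hload⟩ := ih s' ((Finset.filter_subset _ _).trans hs) hW'
    classical
    set α' := Function.update α i a with hα'
    set β' : ℕ → ℕ := fun p => if p < 2 ^ i then β p else
      if load s w f (p - 2 ^ i) ≤ 3 / 5 * M then 1 else 0 with hβ'
    have hflt : ∀ u, f u < 2 ^ i := fun u => cellHash_lt hm (by positivity) _ _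
    have hlow : ∀ u, slot m α' β' u i = slot m α β u i := fun u =>
      slot_congr hm u (fun k hk => Function.update_of_ne hk.ne _ _)
        (fun c hc => if_pos hc)
    have hslot : ∀ u, slot m α' β' u (i + 1) =
        if load s w f (f u) ≤ 3 / 5 * M then 2 ^ i + f u else slot m α β u i := by
      intro u
      rw [slot, hlow, hα', Function.update_self, ← hf, hβ']
      simp only [Nat.not_lt.2 (Nat.le_add_right _ _), if_false, Nat.add_sub_cancel_left]
      split_ifs <;> simp_all
    refine ⟨α', β', fun k => ?_, fun c => ?_, fun p => ?_⟩
    · by_cases hk : k = i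
      · subst hk; simpa [hα'] using ha
      · rw [hα', Function.update_of_ne hk]; exact hα k
    · simp only [hβ']
      split_ifs
      · exact hβ c
      all_goals norm_num
    · simp only [hslot]
      by_cases hp : p < 2 ^ i
      · refine le_trans (Finset.sum_le_sum_of_subset_of_nonneg ?_ fun u _ _ => hw u) (hload p)
        intro u hu
        obtain ⟨hus, hu⟩ := Finset.mem_filter.1 hu
        split_ifs at hu with hl
        · omega
        · exact Finset.mem_filter.2 ⟨Finset.mem_filter.2 ⟨hus, not_le.1 hl⟩, hu⟩
      · by_cases hl : load s w f (p - 2 ^ i) ≤ 3 / 5 * M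
        · refine le_trans (Finset.sum_le_sum_of_subset_of_nonneg ?_ fun u _ _ => hw u) hl
          intro u hu
          obtain ⟨hus, hu⟩ := Finset.mem_filter.1 hu
          have := slot_lt hm α β u i
          split_ifs at hu with hl'
          · exact Finset.mem_filter.2 ⟨hus, by omega⟩
          · omega
        · rw [Finset.sum_eq_zero]
          · positivity
          · intro u hu
            exfalso
            obtain ⟨hus, hu⟩ := Finset.mem_filter.1 hu
            have := slot_lt hm α β u i
            split_ifs at hu with hl'
            · apply hl
              rwa [← hu, Nat.add_sub_cancel_left]
            · omega

/-! ### Grouping the slots into buckets -/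

/-- A sequence of weights of at most `3 / 5 * M` and total between `(t - 1 / 4) * M` and `t * M` is
cut into `t` groups of consecutive terms, each of weight about `M`: a new group starts after each
term with which the partial sums pass a multiple of `M`. -/
theorem exists_grouping {t P : ℕ} (ht : 1 ≤ t) {l : ℕ → ℝ} {M : ℝ} (hM : 0 < M)
    (hl : ∀ p, 0 ≤ l p) (hl' : ∀ p, l p ≤ 3 / 5 * M)
    (hlo : (t - 1 / 4) * M ≤ ∑ p ∈ Finset.range P, l p)
    (hhi : ∑ p ∈ Finset.range P, l p ≤ t * M) :
    ∃ β : ℕ → ℕ, (∀ c, β c < 2) ∧ ∀ i < t,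
      M / 10 ≤ ∑ p ∈ Finset.range P with min (∑ q ∈ Finset.range p, β q) (t - 1) = i, l p ∧
      ∑ p ∈ Finset.range P with min (∑ q ∈ Finset.range p, β q) (t - 1) = i, l p ≤ 2 * M := by
  set F : ℕ → ℝ := fun p => ∑ q ∈ Finset.range p, l q with hF
  have hFs : ∀ p, F (p + 1) = F p + l p := fun p => Finset.sum_range_succ _ _
  have hF0 : ∀ p, 0 ≤ F p := fun p => Finset.sum_nonneg fun q _ => hl q
  have hFmono : Monotone F := monotone_nat_of_le_succ fun p => by rw [hFs]; linarith [hl p]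
  set g : ℕ → ℕ := fun p => ⌊F p / M⌋₊ with hg
  have hgle : ∀ p, (g p : ℝ) * M ≤ F p := fun p => by
    rw [← le_div_iff₀ hM]; exact Nat.floor_le (div_nonneg (hF0 p) hM.le)
  have hglt : ∀ p, F p < ((g p : ℝ) + 1) * M := fun p => by
    rw [← div_lt_iff₀ hM]; exact Nat.lt_floor_add_one _
  have hgmono : ∀ p, g p ≤ g (p + 1) := fun p =>
    Nat.floor_mono (div_le_div_of_nonneg_right (hFmono (Nat.le_succ p)) hM.le)
  have hgstep : ∀ p, g (p + 1) < g p + 2 := fun p => by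
    have h1 := hgle (p + 1)
    have h2 := hglt p
    rw [hFs] at h1
    have h3 : (g (p + 1) : ℝ) * M < ((g p : ℝ) + 2) * M := by nlinarith [hl' p]
    have h4 := lt_of_mul_lt_mul_right h3 hM.le
    exact_mod_cast h4
  have hgsum : ∀ p, ∑ q ∈ Finset.range p, (g (q + 1) - g q) = g p := fun p => by
    rw [Finset.sum_range_tsub (monotone_nat_of_le_succ hgmono)]
    simp [hg, hF]
  refine ⟨fun q => g (q + 1) - g q, fun c => ?_, fun i hi => ?_⟩
  · have := hgstep c
    change g (c + 1) - g c < 2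
    omega
  simp only [hgsum]
  have hit : (i : ℝ) + 1 ≤ t := by exact_mod_cast hi
  constructor
  · -- Only terms that start in `[i * M, (i + 1) * M)` can move a partial sum through the interval
    -- from `i * M + 3 / 5 * M` to `(i + 1) * M`.
    have key : ∀ k, min (F k) ((i + 1) * M) - (i * M + 3 / 5 * M) ≤
        ∑ p ∈ Finset.range k with g p = i, l p := by
      intro k
      induction k with
      | zero =>
        have : min (F 0) ((i + 1) * M) ≤ 0 := (min_le_left _ _).trans (by simp [hF])
        exact sub_nonpos.2 (this.trans (by positivity))
      | succ k ih =>
        rw [Finset.sum_filter, Finset.sum_range_succ, ← Finset.sum_filter]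
        have hnn : 0 ≤ ∑ p ∈ Finset.range k with g p = i, l p :=
          Finset.sum_nonneg fun p _ => hl p
        rcases lt_trichotomy (g k) i with h | h | h
        · have h1 : ((g k : ℝ) + 1) ≤ i := by exact_mod_cast h
          have h2 := hglt k
          have h3 : ((g k : ℝ) + 1) * M ≤ i * M := mul_le_mul_of_nonneg_right h1 hM.le
          have h4 := min_le_left (F (k + 1)) ((i + 1) * M)
          rw [if_neg h.ne]
          rw [hFs] at h4 ⊢
          linarith [hl' k]
        · rw [if_pos h, hFs]
          have : min (F k + l k) ((i + 1) * M) ≤ min (F k) ((i + 1) * M) + l k := by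
            rw [← min_add_add_right]
            exact min_le_min le_rfl (by linarith [hl k])
          linarith
        · have h1 : (i : ℝ) + 1 ≤ g k := by exact_mod_cast h
          have h3 : ((i : ℝ) + 1) * M ≤ F k :=
            (mul_le_mul_of_nonneg_right h1 hM.le).trans (hgle k)
          have h4 : min (F k) ((i + 1) * M) = (i + 1) * M := min_eq_right h3
          have h5 := min_le_right (F (k + 1)) ((i + 1) * M)
          rw [if_neg h.ne']
          rw [h4] at ih
          linarith
    have h1 := key P
    have h2 : ∑ p ∈ Finset.range P with g p = i, l p ≤
        ∑ p ∈ Finset.range P with min (g p) (t - 1) = i, l p := by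
      refine Finset.sum_le_sum_of_subset_of_nonneg (fun p hp => ?_) fun p _ _ => hl p
      obtain ⟨hp, h⟩ := Finset.mem_filter.1 hp
      exact Finset.mem_filter.2 ⟨hp, by omega⟩
    have h3 : (i + 3 / 4) * M ≤ min (F P) ((i + 1) * M) := by
      refine le_min (le_trans ?_ hlo) ?_ <;> nlinarith
    linarith
  · -- Terms of the group start and end in `[i * M, (i + 1) * M + 3 / 5 * M]`; the total bounds the
    -- end of the last group, which also collects all later terms.
    have key : ∀ k ≤ P, ∑ p ∈ Finset.range k with min (g p) (t - 1) = i, l p ≤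
        max 0 (min (F k) ((i + 1) * M + 3 / 5 * M) - i * M) := by
      intro k
      induction k with
      | zero => simp
      | succ k ih =>
        intro hk
        have ih := ih (by omega)
        rw [Finset.sum_filter, Finset.sum_range_succ, ← Finset.sum_filter]
        have hmono : min (F k) ((i + 1) * M + 3 / 5 * M) ≤
            min (F (k + 1)) ((i + 1) * M + 3 / 5 * M) :=
          min_le_min (hFmono (Nat.le_succ k)) le_rfl
        split_ifs with h
        · have h1 : (i : ℝ) * M ≤ F k := by
            have : (i : ℝ) ≤ g k := by exact_mod_cast (show i ≤ g k by omega)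
            exact (mul_le_mul_of_nonneg_right this hM.le).trans (hgle k)
          have h2 : F (k + 1) ≤ (i + 1) * M + 3 / 5 * M := by
            rcases Nat.lt_or_ge (g k) t with h3 | h3
            · have h4 : g k = i := by omega
              have h5 := hglt k
              rw [h4] at h5
              rw [hFs]
              linarith [hl' k]
            · have h4 : (t : ℝ) = i + 1 := by
                have : t = i + 1 := by omega
                exact_mod_cast this
              have h5 := (hFmono hk).trans hhi
              rw [h4] at h5
              linarith
          have h3 : F k ≤ (i + 1) * M + 3 / 5 * M := (hFmono (Nat.le_succ k)).trans h2
          rw [min_eq_left h3, max_eq_right (by linarith)] at ih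
          rw [min_eq_left h2]
          refine le_trans ?_ (le_max_right _ _)
          rw [hFs]
          linarith
        · rw [add_zero]
          exact ih.trans (max_le_max le_rfl (by linarith))
    refine (key P le_rfl).trans (max_le (by linarith) ?_)
    have := min_le_right (F P) ((i + 1) * M + 3 / 5 * M)
    linarith

/-! ### Encoding the parameters in numbers -/

theorem exists_digit_eq {b : ℕ} (hb : 0 < b) (k : ℕ) (α : ℕ → ℕ) (hα : ∀ i < k, α i < b) :
    ∃ X < b ^ k, ∀ i < k, digit b X i = α i := by
  induction k generalizing α with
  | zero => exact ⟨0, by simp, by simp⟩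
  | succ k ih =>
    obtain ⟨X, hX, h⟩ := ih (fun i => α (i + 1)) fun i hi => hα (i + 1) (by omega)
    have h0 := hα 0 (by omega)
    refine ⟨α 0 + b * X, ?_, fun i hi => ?_⟩
    · have : b * (X + 1) ≤ b * b ^ k := Nat.mul_le_mul_left b hX
      rw [pow_succ, mul_comm (b ^ k)]
      rw [mul_add] at this
      omega
    · cases i with
      | zero => simp [digit, Nat.mod_eq_of_lt h0]
      | succ i =>
        rw [← h i (by omega), digit, digit, pow_succ', ← Nat.div_div_eq_div_mul,
          Nat.add_mul_div_left _ _ hb, Nat.div_eq_of_lt h0, zero_add]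

theorem sigWidth_pow_levels_le {t : ℕ} (ht : 1 ≤ t) : sigWidth t ^ levels t ≤ seeds t := by
  set L := Nat.clog 2 t with hL
  have htL : t ≤ 2 ^ L := Nat.le_pow_clog (by norm_num) t
  have h1 : sigWidth t ≤ 2 ^ (16 + 3 * L) := by
    calc sigWidth t = 2 ^ 16 * t ^ 3 := by simp only [sigWidth, fineCells, blocks]; ring
      _ ≤ 2 ^ 16 * (2 ^ L) ^ 3 := Nat.mul_le_mul_left _ (Nat.pow_le_pow_left htL 3)
      _ = 2 ^ (16 + 3 * L) := by rw [pow_add, ← pow_mul, mul_comm L]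
  have h2 : levels t ≤ 6 + L := by
    refine Nat.clog_le_of_le_pow ?_
    rw [pow_add, blocks]
    omega
  have hLt : L ≤ t := Nat.clog_le_of_le_pow Nat.lt_two_pow_self.le
  have hsq : ∀ k, (k + 1) ^ 2 ≤ 4 * 2 ^ k := by
    intro k
    rcases Nat.lt_or_ge k 2 with h | h
    · interval_cases k <;> norm_num
    · induction k, h using Nat.le_induction with
      | base => norm_num
      | succ k hk ih => rw [pow_succ 2 k]; nlinarith
  have hLL : L ^ 2 ≤ 4 * t := by
    rcases Nat.eq_zero_or_pos L with h | h
    · simp [h]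
    · have h3 : 2 ^ (L - 1) < t := (Nat.lt_clog_iff_pow_lt (by norm_num)).1 (by omega)
      have h4 := hsq (L - 1)
      rw [Nat.sub_add_cancel h] at h4
      omega
  calc sigWidth t ^ levels t ≤ (2 ^ (16 + 3 * L)) ^ (6 + L) :=
        (Nat.pow_le_pow_left h1 _).trans (Nat.pow_le_pow_right (by positivity) h2)
    _ = 2 ^ ((16 + 3 * L) * (6 + L)) := by rw [← pow_mul]
    _ ≤ seeds t := Nat.pow_le_pow_right (by norm_num) (by nlinarith)

theorem two_pow_two_pow_levels_le {t : ℕ} (ht : 1 ≤ t) : 2 ^ 2 ^ levels t ≤ seeds t := by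
  refine Nat.pow_le_pow_right (by norm_num) ?_
  have := two_pow_levels_lt ht
  unfold blocks at this
  omega

/-! ### Balanced members of the family -/

theorem exists_light_block {n R : ℕ} (hR : 0 < R) (z : ℕ → ℝ) :
    ∃ r < R, ∑ j ∈ Finset.range n with j % R = r, z j ≤ (∑ j ∈ Finset.range n, z j) / R := by
  have hR' : (R : ℝ) ≠ 0 := by exact_mod_cast hR.ne'
  have hle : ∑ r ∈ Finset.range R, ∑ j ∈ Finset.range n with j % R = r, z j ≤
      ∑ _r ∈ Finset.range R, (∑ j ∈ Finset.range n, z j) / R := by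
    rw [Finset.sum_fiberwise_of_maps_to (fun j _ => Finset.mem_range.2 (Nat.mod_lt j hR))]
    simp only [Finset.sum_const, Finset.card_range, nsmul_eq_mul]
    exact le_of_eq (by field_simp)
  obtain ⟨r, hr, h⟩ := Finset.exists_le_of_sum_le (Finset.nonempty_range_iff.2 hR.ne') hle
  exact ⟨r, Finset.mem_range.1 hr, h⟩

/-- If the signature block is light and the multiplier `a` causes few collisions, then some choice
of the remaining parameters yields buckets of weight between `M / 10` and `3 * M`. -/
theorem exists_balanced_value {n t : ℕ} (ht : 1 ≤ t) {z : ℕ → ℝ} {M : ℝ}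
    (hz0 : ∀ j, 0 ≤ z j) (hz1 : ∀ j, z j ≤ 1) (hS : ∑ j ∈ Finset.range n, z j = t * M)
    (hM : 10 ≤ M) {r : ℕ} (hr : r < blocks t)
    (hblock : ∑ j ∈ Finset.range n with j % blocks t = r, z j ≤ M / 64) {a : ℕ}
    (hcol : collisions ((Finset.range n).filter fun j => ¬ j % blocks t = r) z
      (cellHash n (fineCells t) a) ≤ M ^ 2 / 128) :
    ∃ X < seeds t, ∃ Y < seeds t, ∃ Z < seeds t, ∀ i < t,
      M / 10 ≤ ∑ j ∈ Finset.range n with min (value n t a r X Y Z j) (t - 1) = i, z j ∧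
      ∑ j ∈ Finset.range n with min (value n t a r X Y Z j) (t - 1) = i, z j ≤ 3 * M := by
  have hM0 : 0 < M := by linarith
  have hm := fineCells_pos ht
  set s := (Finset.range n).filter fun j => ¬ j % blocks t = r with hs
  set f := cellHash n (fineCells t) a with hf
  have hfm : ∀ j ∈ s, f j ∈ Finset.range (fineCells t) := fun j hj => by
    have : j < n := Finset.mem_range.1 (Finset.mem_filter.1 hj).1
    exact Finset.mem_range.2 (cellHash_lt (by omega) hm _ _)
  have hsplit : ∑ j ∈ Finset.range n with j % blocks t = r, z j + ∑ j ∈ s, z j = t * M := by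
    rw [hs, Finset.sum_filter_add_sum_filter_not, hS]
  -- After the first hash function no cell has more weight than `M / 5`.
  have hload : ∀ u, load s z f u ≤ M / 5 := by
    intro u
    by_contra! h
    have h1 := load_mul_sub_le_collisions (s := s) (w := z) (f := f) (μ := 1) (fun j _ => hz0 j)
      (fun j _ => hz1 j) u
    nlinarith
  have hsum : ∑ u ∈ Finset.range (fineCells t), load s z f u = ∑ j ∈ s, z j :=
    Finset.sum_fiberwise_of_maps_to hfm z
  have hle : ∑ j ∈ s, z j ≤ t * M := by
    have : 0 ≤ ∑ j ∈ Finset.range n with j % blocks t = r, z j :=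
      Finset.sum_nonneg fun j _ => hz0 j
    linarith
  obtain ⟨α, β, hα, hβ, hslot⟩ := exists_slot_load_le hm hM0
    (fun u => load_nonneg (s := s) (f := f) (fun j _ => hz0 j) u) hload (levels t)
    (Finset.range (fineCells t)) subset_rfl (by
      have h1 : blocks t ≤ 2 ^ levels t := Nat.le_pow_clog (by norm_num) _
      have h2 : (64 : ℝ) * t ≤ 2 ^ levels t := by
        have : ((blocks t : ℕ) : ℝ) ≤ ((2 ^ levels t : ℕ) : ℝ) := by exact_mod_cast h1
        simpa [blocks] using this
      rw [hsum]
      nlinarith)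
  have hαQ : ∀ k < levels t, α k < sigWidth t := by
    intro k hk
    have h1 : 2 ^ k < blocks t := (Nat.lt_clog_iff_pow_lt (by norm_num)).1 hk
    exact (hα k).trans_le (Nat.mul_le_mul_left _ h1.le)
  obtain ⟨X, hX, hXα⟩ := exists_digit_eq (sigWidth_pos ht) (levels t) α hαQ
  obtain ⟨Y, hY, hYβ⟩ := exists_digit_eq two_pos (2 ^ levels t) β fun c _ => hβ c
  set σ : ℕ → ℕ := fun j => slot (fineCells t) (digit (sigWidth t) X) (digit 2 Y) (f j)
    (levels t) with hσ
  have hσlt : ∀ j, σ j < 2 ^ levels t := fun j => slot_lt hm _ _ _ _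
  set l : ℕ → ℝ := fun p => ∑ j ∈ s with σ j = p, z j with hl
  have hl0 : ∀ p, 0 ≤ l p := fun p => Finset.sum_nonneg fun j _ => hz0 j
  have hlle : ∀ p, l p ≤ 3 / 5 * M := by
    intro p
    refine le_trans (le_of_eq ?_) (hslot p)
    have hσα : ∀ u, slot (fineCells t) (digit (sigWidth t) X) (digit 2 Y) u (levels t) =
        slot (fineCells t) α β u (levels t) := fun u => slot_congr hm u hXα hYβ
    simp only [hl, hσ, hσα, load]
    rw [← Finset.sum_fiberwise_of_maps_to (s := {j ∈ s | slot _ α β (f j) _ = p})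
      (t := {u ∈ Finset.range (fineCells t) | slot _ α β u (levels t) = p}) (g := f)]
    · refine Finset.sum_congr rfl fun u hu => Finset.sum_congr ?_ fun _ _ => rfl
      ext j
      have := (Finset.mem_filter.1 hu).2
      simp only [Finset.mem_filter]
      constructor
      · rintro ⟨⟨h1, -⟩, h2⟩; exact ⟨h1, h2⟩
      · rintro ⟨h1, rfl⟩; exact ⟨⟨h1, this⟩, rfl⟩
    · intro j hj
      obtain ⟨h1, h2⟩ := Finset.mem_filter.1 hj
      exact Finset.mem_filter.2 ⟨hfm j h1, h2⟩
  have hltot : ∑ p ∈ Finset.range (2 ^ levels t), l p = ∑ j ∈ s, z j :=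
    Finset.sum_fiberwise_of_maps_to (fun j _ => Finset.mem_range.2 (hσlt j)) z
  obtain ⟨γ, hγ, hgroup⟩ := exists_grouping (P := 2 ^ levels t) ht hM0 hl0 hlle
    (by rw [hltot]; linarith) (by rw [hltot]; exact hle)
  obtain ⟨Z, hZ, hZγ⟩ := exists_digit_eq two_pos (2 ^ levels t) γ fun c _ => hγ c
  have hrank : ∀ p < 2 ^ levels t, rank Z p = ∑ q ∈ Finset.range p, γ q := fun p hp =>
    Finset.sum_congr rfl fun q hq => hZγ q ((Finset.mem_range.1 hq).trans hp)
  have hpow := sigWidth_pow_levels_le ht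
  have hpow2 := two_pow_two_pow_levels_le ht
  refine ⟨X, by omega, Y, by omega, Z, by omega, fun i hi => ?_⟩
  obtain ⟨hlo, hhi⟩ := hgroup i hi
  have hbucket : ∑ p ∈ Finset.range (2 ^ levels t) with
      min (∑ q ∈ Finset.range p, γ q) (t - 1) = i, l p =
      ∑ j ∈ s with min (value n t a r X Y Z j) (t - 1) = i, z j := by
    rw [← Finset.sum_fiberwise_of_maps_to
      (t := {p ∈ Finset.range (2 ^ levels t) | min (∑ q ∈ Finset.range p, γ q) (t - 1) = i})
      (s := {j ∈ s | min (value n t a r X Y Z j) (t - 1) = i}) (g := σ)]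
    · refine Finset.sum_congr rfl fun p hp => Finset.sum_congr ?_ fun _ _ => rfl
      obtain ⟨hp1, hp2⟩ := Finset.mem_filter.1 hp
      ext j
      simp only [Finset.mem_filter]
      constructor
      · rintro ⟨h1, rfl⟩
        refine ⟨⟨h1, ?_⟩, rfl⟩
        rw [value, if_pos hr, if_neg (Finset.mem_filter.1 h1).2]
        change min (rank Z (σ j)) (t - 1) = i
        rw [hrank _ (hσlt j), hp2]
      · rintro ⟨⟨h1, -⟩, h2⟩; exact ⟨h1, h2⟩
    · intro j hj
      obtain ⟨h1, h2⟩ := Finset.mem_filter.1 hj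
      rw [value, if_pos hr, if_neg (Finset.mem_filter.1 h1).2] at h2
      change min (rank Z (σ j)) (t - 1) = i at h2
      rw [hrank _ (hσlt j)] at h2
      exact Finset.mem_filter.2 ⟨Finset.mem_range.2 (hσlt j), h2⟩
  rw [hbucket] at hlo hhi
  have hsub : s.filter (fun j => min (value n t a r X Y Z j) (t - 1) = i) ⊆
      (Finset.range n).filter fun j => min (value n t a r X Y Z j) (t - 1) = i :=
    Finset.filter_subset_filter _ (Finset.filter_subset _ _)
  have hcover : (Finset.range n).filter (fun j => min (value n t a r X Y Z j) (t - 1) = i) ⊆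
      s.filter (fun j => min (value n t a r X Y Z j) (t - 1) = i) ∪
        (Finset.range n).filter fun j => j % blocks t = r := by
    intro j hj
    simp only [hs, Finset.mem_filter, Finset.mem_union] at hj ⊢
    tauto
  constructor
  · exact hlo.trans (Finset.sum_le_sum_of_subset_of_nonneg hsub fun j _ _ => hz0 j)
  · have h1 := Finset.sum_le_sum_of_subset_of_nonneg hcover fun j _ _ => hz0 j
    have h2 := Finset.sum_union_inter (s₁ := s.filter fun j =>
      min (value n t a r X Y Z j) (t - 1) = i)
      (s₂ := (Finset.range n).filter fun j => j % blocks t = r) (f := z)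
    have h3 : 0 ≤ ∑ j ∈ s.filter (fun j => min (value n t a r X Y Z j) (t - 1) = i) ∩
        (Finset.range n).filter (fun j => j % blocks t = r), z j :=
      Finset.sum_nonneg fun j _ => hz0 j
    linarith

/-- The signature reveals the multiplier up to `sigWidth t` possibilities. -/
theorem div_sigWidth_eq {n t r : ℕ} (ht : 2 ≤ t) (hr : r < blocks t) {a a' X X' Y Y' Z Z' : ℕ}
    (ha : a < n * fineCells t) (ha' : a' < n * fineCells t)
    (h : ∀ j < n, min (value n t a r X Y Z j) (t - 1) = min (value n t a' r X' Y' Z' j) (t - 1)) :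
    a / sigWidth t = a' / sigWidth t := by
  have hR : 0 < blocks t := by omega
  have hlt : ∀ b, b < n * fineCells t → blocks t * (b / sigWidth t) < n := by
    intro b hb
    have h1 : sigWidth t * (b / sigWidth t) ≤ b := Nat.mul_div_le _ _
    have h2 : fineCells t * (blocks t * (b / sigWidth t)) < fineCells t * n := by
      rw [← mul_assoc, mul_comm _ n]; exact h1.trans_lt hb
    exact Nat.lt_of_mul_lt_mul_left h2
  have key : ∀ q, blocks t * q + r < n → (q = a / sigWidth t ↔ q = a' / sigWidth t) := by
    intro q hq
    have h1 := h _ hq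
    have h2 : (blocks t * q + r) % blocks t = r := by
      rw [Nat.mul_add_mod, Nat.mod_eq_of_lt hr]
    have h3 : (blocks t * q + r) / blocks t = q := by
      rw [Nat.mul_add_div hR, Nat.div_eq_of_lt hr, add_zero]
    simp only [value, if_pos hr, h2, h3, if_true] at h1
    split_ifs at h1 with h4 h5 h5
    · tauto
    · omega
    · omega
    · tauto
  have h1 := hlt a ha
  have h2 := hlt a' ha'
  rcases lt_trichotomy (a / sigWidth t) (a' / sigWidth t) with hq | hq | hq
  · have := Nat.mul_le_mul_left (blocks t) (show a / sigWidth t + 1 ≤ a' / sigWidth t from hq)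
    rw [mul_add] at this
    exact (key _ (by omega)).1 rfl
  · exact hq
  · have := Nat.mul_le_mul_left (blocks t) (show a' / sigWidth t + 1 ≤ a / sigWidth t from hq)
    rw [mul_add] at this
    exact ((key _ (by omega)).2 rfl).symm

/-! ### The family as a set -/

/-- The map `[n] → [t]` with the given parameters. -/
def hashMap (n t : ℕ) (ht : 0 < t) (a r X Y Z : ℕ) : Fin n → Fin t := fun j =>
  ⟨min (value n t a r X Y Z j) (t - 1), by omega⟩

/-- All maps with parameters in the prescribed ranges, in the order in which they are listed. -/
def hashList (n t : ℕ) (ht : 0 < t) : List (Fin n → Fin t) :=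
  (List.range (n * fineCells t)).flatMap fun a => (List.range (seeds t)).flatMap fun r =>
  (List.range (seeds t)).flatMap fun X => (List.range (seeds t)).flatMap fun Y =>
  (List.range (seeds t)).flatMap fun Z => [hashMap n t ht a r X Y Z]

/-- The family; the case `t = 0` is irrelevant. -/
def hashFamily (n t : ℕ) : Finset (Fin n → Fin t) :=
  if ht : 0 < t then (hashList n t ht).toFinset else ∅

theorem mem_hashFamily {n t : ℕ} (ht : 0 < t) {h : Fin n → Fin t} :
    h ∈ hashFamily n t ↔ ∃ a < n * fineCells t, ∃ r < seeds t, ∃ X < seeds t, ∃ Y < seeds t,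
      ∃ Z < seeds t, h = hashMap n t ht a r X Y Z := by
  simp [hashFamily, ht, hashList]

theorem describe_hashList {n t : ℕ} (ht : 0 < t) : describe (hashList n t ht) =
    (List.range (n * fineCells t)).flatMap fun a => (List.range (seeds t)).flatMap fun r =>
      (List.range (seeds t)).flatMap fun X => (List.range (seeds t)).flatMap fun Y =>
      (List.range (seeds t)).flatMap fun Z => (List.range n).flatMap fun j =>
        [min (value n t a r X Y Z j) (t - 1)] := by
  simp only [describe, hashList, List.flatMap_assoc, List.flatMap_singleton]
  have : ∀ a r X Y Z, (List.ofFn fun j => ((hashMap n t ht a r X Y Z j : Fin t) : ℕ)) =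
      (List.range n).flatMap fun j => [min (value n t a r X Y Z j) (t - 1)] := by
    intro a r X Y Z
    rw [List.ofFn_eq_map, ← List.map_coe_finRange_eq_range, List.flatMap_map]
    simp [hashMap, List.map_eq_flatMap]
  simp only [this]

theorem card_hashFamily_le {n t : ℕ} (ht : 0 < t) :
    (hashFamily n t).card ≤ n * fineCells t * seeds t ^ 4 := by
  rw [hashFamily, dif_pos ht]
  refine (List.toFinset_card_le _).trans (le_of_eq ?_)
  simp only [hashList, List.length_flatMap, List.length_singleton, List.map_const',
    List.length_range, List.sum_replicate, smul_eq_mul]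
  ring

theorem hashFamily_nonempty {n t : ℕ} (ht : 0 < t) (hn : 0 < n) : (hashFamily n t).Nonempty := by
  have hs : 0 < seeds t := by unfold seeds; positivity
  exact ⟨_, (mem_hashFamily ht).2 ⟨0, Nat.mul_pos hn (fineCells_pos ht), 0, hs, 0, hs, 0, hs, 0, hs,
    rfl⟩⟩

theorem eq_of_digit_two_eq {k x y : ℕ} (hx : x < 2 ^ k) (hy : y < 2 ^ k)
    (h : ∀ i < k, digit 2 x i = digit 2 y i) : x = y := by
  refine Nat.eq_of_testBit_eq fun i => ?_
  rcases Nat.lt_or_ge i k with hi | hi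
  · have := h i hi
    unfold digit at this
    rw [Nat.testBit_eq_decide_div_mod_eq, Nat.testBit_eq_decide_div_mod_eq, this]
  · have h2 : 2 ^ k ≤ 2 ^ i := Nat.pow_le_pow_right (by norm_num) hi
    rw [Nat.testBit_lt_two_pow (hx.trans_le h2), Nat.testBit_lt_two_pow (hy.trans_le h2)]

/-- The family is so large that a running time exponential in `t` is polynomial in its size: the
maps with `r = blocks t` take all patterns of zeros and ones on the first `t` positions. -/
theorem two_pow_le_card_hashFamily {n t : ℕ} (ht : 0 < t) (htn : t ≤ n) :
    2 ^ t ≤ 2 * (hashFamily n t).card := by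
  rcases Nat.lt_or_ge t 2 with h2 | h2
  · obtain rfl : t = 1 := by omega
    have := (hashFamily_nonempty (n := n) ht (by omega)).card_pos
    omega
  have hs : 0 < seeds t := by unfold seeds; positivity
  have hts : 2 ^ t ≤ seeds t := Nat.pow_le_pow_right (by norm_num) (by omega)
  have hb := mul_blocks_le_seeds ht
  have hb0 : 0 < blocks t := by unfold blocks; omega
  have hle : (Finset.range (2 ^ t)).card ≤ (hashFamily n t).card := by
    refine Finset.card_le_card_of_injOn (fun Y => hashMap n t ht 0 (blocks t) 0 Y 0) ?_ ?_
    · intro Y hY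
      have hY : Y < 2 ^ t := by simpa using hY
      exact (mem_hashFamily ht).2 ⟨0, Nat.mul_pos (by omega) (fineCells_pos ht), blocks t,
        by omega, 0, hs, Y, by omega, 0, hs, rfl⟩
    · intro Y hY Y' hY' heq
      refine eq_of_digit_two_eq (k := t) (by simpa using hY) (by simpa using hY') fun i hi => ?_
      have h3 := congrArg Fin.val (congrFun heq ⟨i, by omega⟩)
      simp only [hashMap, value, lt_irrefl, if_false] at h3
      have h4 : digit 2 Y i < 2 := Nat.mod_lt _ two_pos
      have h5 : digit 2 Y' i < 2 := Nat.mod_lt _ two_pos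
      omega
  rw [Finset.card_range] at hle
  omega

theorem isExplicit_hashFamily : IsExplicit hashFamily := by
  refine ⟨RAM.mainProg, 8000 * (2 ^ 256) ^ 9 + 2304, fun n t ht htn =>
    ⟨hashList n t ht, fun h => by simp [hashFamily, show 0 < t from ht], ?_⟩⟩
  obtain ⟨s, T, hx, hT, ho⟩ := RAM.runs_mainProg (n := n) ht (by omega)
  refine ⟨s, T, hx, ho.trans (describe_hashList ht).symm, hT.trans ?_⟩
  have hcard := two_pow_le_card_hashFamily ht htn
  have hpos : 1 ≤ n * (hashFamily n t).card :=
    Nat.mul_pos (by omega) (hashFamily_nonempty ht (by omega)).card_pos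
  -- The time is polynomial in `n ^ 2 * (2 ^ t) ^ 256`, and `2 ^ t` is at most twice the size.
  generalize (hashFamily n t).card = c at hcard hpos
  have hU : timeUnit n t ≤ 2 ^ 256 * (n * c) ^ 256 := by
    calc timeUnit n t = n ^ 2 * (2 ^ t) ^ 256 := by rw [timeUnit, seeds, ← pow_mul, mul_comm 256]
      _ ≤ n ^ 256 * (2 * c) ^ 256 :=
          Nat.mul_le_mul (Nat.pow_le_pow_right (by omega) (by norm_num))
            (Nat.pow_le_pow_left hcard _)
      _ = 2 ^ 256 * (n * c) ^ 256 := by rw [mul_pow, mul_pow]; ring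
  calc 8000 * timeUnit n t ^ 9 ≤ 8000 * (2 ^ 256 * (n * c) ^ 256) ^ 9 := by gcongr
    _ = 8000 * (2 ^ 256) ^ 9 * (n * c) ^ 2304 := by
        rw [mul_pow, ← pow_mul (n * c), mul_assoc]
    _ ≤ _ := by
        generalize 8000 * (2 ^ 256) ^ 9 = A
        exact Nat.mul_le_mul (Nat.le_add_right _ _)
          (Nat.pow_le_pow_right hpos (Nat.le_add_left _ _))

theorem isBalanced_hashMap_iff {n t : ℕ} (ht : 0 < t) (z : ℕ → ℝ) (a r X Y Z : ℕ) :
    IsBalanced (fun j : Fin n => z j) (hashMap n t ht a r X Y Z) ↔ ∀ i < t,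
      ∑ j ∈ Finset.range n with min (value n t a r X Y Z j) (t - 1) = i, z j ∈
        Set.Icc (0.01 * ((∑ j ∈ Finset.range n, z j) / t))
          (10 * ((∑ j ∈ Finset.range n, z j) / t)) := by
  have h1 : ∀ i : Fin t, ∑ j : Fin n with hashMap n t ht a r X Y Z j = i, z j =
      ∑ j ∈ Finset.range n with min (value n t a r X Y Z j) (t - 1) = i, z j := by
    intro i
    rw [Finset.sum_filter, Finset.sum_filter, ← Fin.sum_univ_eq_sum_range
      (fun j => if min (value n t a r X Y Z j) (t - 1) = i then z j else 0)]
    refine Finset.sum_congr rfl fun j _ => ?_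
    simp only [hashMap, Fin.ext_iff]
  have h2 := Fin.sum_univ_eq_sum_range z n
  simp only [IsBalanced, h1, h2]
  exact ⟨fun h i hi => h ⟨i, hi⟩, fun h i => h i i.2⟩

theorem isBalanced_of_subsingleton {n : ℕ} {z : Fin n → ℝ} (hz : 0 ≤ ∑ j, z j)
    (h : Fin n → Fin 1) : IsBalanced z h := by
  intro i
  have : ∑ j with h j = i, z j = ∑ j, z j := by
    congr 1
    exact Finset.filter_true_of_mem fun j _ => Subsingleton.elim _ _
  rw [this, Set.mem_Icc]
  constructor <;> norm_num <;> linarith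

open Classical in
/-- The balanced maps form a fraction of the family that depends on `t` only: half of the
multipliers `a` extend to a balanced map with signature in a fixed block, and each such map arises
from at most `sigWidth t` multipliers. -/
theorem card_hashFamily_le_mul_card_balanced {n t : ℕ} (ht : 2 ≤ t) {z : ℕ → ℝ}
    (hz0 : ∀ j, 0 ≤ z j) (hz1 : ∀ j, z j ≤ 1) (hS : 10 * (t : ℝ) ≤ ∑ j ∈ Finset.range n, z j) :
    (hashFamily n t).card ≤ 2 * sigWidth t * seeds t ^ 4 *
      ((hashFamily n t).filter (IsBalanced fun j : Fin n => z j)).card := by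
  have ht0 : 0 < t := by omega
  have htR : (0 : ℝ) < t := by exact_mod_cast ht0
  set S := ∑ j ∈ Finset.range n, z j with hSdef
  set M := S / t with hMdef
  have hSM : S = t * M := by rw [hMdef]; field_simp
  have hM : 10 ≤ M := by rw [hMdef, le_div_iff₀ htR]; exact hS
  have hb0 : 0 < blocks t := by unfold blocks; omega
  obtain ⟨r, hr, hblock⟩ := exists_light_block (n := n) hb0 z
  have hblock' : ∑ j ∈ Finset.range n with j % blocks t = r, z j ≤ M / 64 := by
    refine hblock.trans (le_of_eq ?_)
    rw [← hSdef, hSM, blocks]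
    push_cast
    field_simp
  have hrs : r < seeds t := by have := mul_blocks_le_seeds (t := t) (by omega); omega
  set s := (Finset.range n).filter fun j => ¬ j % blocks t = r with hs
  set good := (Finset.range (n * fineCells t)).filter fun a =>
    collisions s z (cellHash n (fineCells t) a) ≤ 8 * S ^ 2 / (fineCells t : ℕ) with hgood
  have hhalf : n * fineCells t ≤ 2 * good.card :=
    le_card_collisions_cellHash_le (fineCells_pos ht0) (Finset.filter_subset _ _)
      (fun j _ => hz0 j)
      (Finset.sum_le_sum_of_subset_of_nonneg (Finset.filter_subset _ _) fun j _ _ => hz0 j)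
      (by nlinarith)
  have hex : ∀ a ∈ good, ∃ X < seeds t, ∃ Y < seeds t, ∃ Z < seeds t,
      IsBalanced (fun j : Fin n => z j) (hashMap n t ht0 a r X Y Z) := by
    intro a ha
    have hcol := (Finset.mem_filter.1 ha).2
    have heq : 8 * S ^ 2 / ((fineCells t : ℕ) : ℝ) = M ^ 2 / 128 := by
      rw [hSM, fineCells]
      push_cast
      field_simp
      norm_num
    rw [heq] at hcol
    obtain ⟨X, hX, Y, hY, Z, hZ, h⟩ :=
      exists_balanced_value (by omega) hz0 hz1 hSM hM hr hblock' hcol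
    refine ⟨X, hX, Y, hY, Z, hZ, (isBalanced_hashMap_iff ht0 z a r X Y Z).2 fun i hi => ?_⟩
    obtain ⟨h1, h2⟩ := h i hi
    rw [← hSdef, ← hMdef]
    constructor <;> norm_num <;> linarith
  choose! X hX Y hY Z hZ hbal using hex
  set φ : ℕ → Fin n → Fin t := fun a => hashMap n t ht0 a r (X a) (Y a) (Z a) with hφ
  have himage : good.image φ ⊆ (hashFamily n t).filter (IsBalanced fun j : Fin n => z j) := by
    intro h hh
    obtain ⟨a, ha, rfl⟩ := Finset.mem_image.1 hh
    refine Finset.mem_filter.2 ⟨(mem_hashFamily ht0).2 ⟨a, ?_, r, hrs, X a, hX a ha, Y a, hY a ha,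
      Z a, hZ a ha, rfl⟩, hbal a ha⟩
    exact Finset.mem_range.1 (Finset.mem_filter.1 ha).1
  have hfiber : good.card ≤ sigWidth t * (good.image φ).card := by
    refine Finset.card_le_mul_card_image _ _ fun h hh => ?_
    obtain ⟨a, ha, rfl⟩ := Finset.mem_image.1 hh
    have hle := Finset.card_le_card_of_injOn (s := good.filter fun b => φ b = φ a)
      (t := Finset.range (sigWidth t)) (fun b => b % sigWidth t)
      (fun b _ => Finset.mem_coe.2 (Finset.mem_range.2 (Nat.mod_lt _ (sigWidth_pos ht0)))) (by
        have hdiv : ∀ b ∈ good.filter fun b => φ b = φ a, b / sigWidth t = a / sigWidth t := by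
          intro b hb
          obtain ⟨hb, hba⟩ := Finset.mem_filter.1 hb
          exact div_sigWidth_eq ht hr (Finset.mem_range.1 (Finset.mem_filter.1 hb).1)
            (Finset.mem_range.1 (Finset.mem_filter.1 ha).1)
            fun j hj => congrArg Fin.val (congrFun hba ⟨j, hj⟩)
        intro b hb b' hb' hbb
        have e1 := Nat.div_add_mod b (sigWidth t)
        have e2 := Nat.div_add_mod b' (sigWidth t)
        rw [hdiv b hb] at e1
        rw [hdiv b' hb'] at e2
        simp only at hbb
        omega)
    rwa [Finset.card_range] at hle
  calc (hashFamily n t).card ≤ n * fineCells t * seeds t ^ 4 := card_hashFamily_le ht0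
    _ ≤ 2 * (sigWidth t * ((hashFamily n t).filter (IsBalanced fun j : Fin n => z j)).card) *
        seeds t ^ 4 := by
        refine Nat.mul_le_mul_right _ (hhalf.trans (Nat.mul_le_mul_left 2 (hfiber.trans ?_)))
        exact Nat.mul_le_mul_left _ (Finset.card_le_card himage)
    _ = _ := by ring

open Classical in
theorem le_prob_of_card_le_mul {α : Type*} {H : Finset α} {P : α → Prop} {k : ℕ} (hk : 0 < k)
    (hH : H.Nonempty) (h : H.card ≤ k * (H.filter P).card) : 1 / (k : ℝ) ≤ prob H P := by
  have h1 : (0 : ℝ) < H.card := by exact_mod_cast hH.card_pos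
  have h2 : (0 : ℝ) < k := by exact_mod_cast hk
  rw [prob, div_le_div_iff₀ h2 h1, one_mul, mul_comm]
  exact_mod_cast h

theorem seeds_pow_five (t : ℕ) : seeds t ^ 5 = 2 ^ (1280 * t) := by
  rw [seeds, ← pow_mul]; congr 1; ring

end FracHash

theorem mainTheorem7 :
    ∃ H : (n t : ℕ) → Finset (Fin n → Fin t),
      FracHash.IsExplicit H ∧
      ∃ c : ℕ, ∀ n t : ℕ, 1 ≤ t → t ≤ n →
        (H n t).Nonempty ∧
        (H n t).card ≤ 2 ^ (c * t) * n ^ c ∧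
        ∀ z : Fin n → ℝ, (∀ j, z j ∈ Set.Icc (0 : ℝ) 1) → 10 * (t : ℝ) ≤ ∑ j, z j →
          1 / (2 : ℝ) ^ (c * t) ≤ FracHash.prob (H n t) (FracHash.IsBalanced z) := by
  classical
  open FracHash in
  refine ⟨hashFamily, isExplicit_hashFamily, 1281, fun n t ht htn => ?_⟩
  have hne := hashFamily_nonempty (n := n) (t := t) ht (by omega)
  have hpow : 2 * seeds t ^ 5 ≤ 2 ^ (1281 * t) := by
    rw [seeds_pow_five, ← pow_succ']
    exact Nat.pow_le_pow_right (by norm_num) (by omega)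
  refine ⟨hne, ?_, fun z hz hS => ?_⟩
  · calc (hashFamily n t).card ≤ n * fineCells t * seeds t ^ 4 := card_hashFamily_le ht
      _ ≤ n * seeds t * seeds t ^ 4 := by gcongr; exact fineCells_le_seeds ht
      _ = seeds t ^ 5 * n := by ring
      _ ≤ 2 ^ (1281 * t) * n ^ 1281 :=
          Nat.mul_le_mul (by omega) (Nat.le_self_pow (by norm_num) n)
  · have hcast : (2 : ℝ) ^ (1281 * t) = ((2 ^ (1281 * t) : ℕ) : ℝ) := by push_cast; rfl
    rw [hcast]
    refine le_prob_of_card_le_mul (by positivity) hne ?_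
    rcases Nat.lt_or_ge t 2 with h2 | h2
    · obtain rfl : t = 1 := by omega
      rw [Finset.filter_true_of_mem fun h _ =>
        isBalanced_of_subsingleton (Finset.sum_nonneg fun j _ => (hz j).1) h]
      exact Nat.le_mul_of_pos_left _ (by positivity)
    · set z' : ℕ → ℝ := fun j => if h : j < n then z ⟨j, h⟩ else 0 with hz'
      have hzz : z = fun j : Fin n => z' j := by funext j; simp [hz']
      have h0 : ∀ j, 0 ≤ z' j := fun j => by
        simp only [hz']; split_ifs with h
        exacts [(hz _).1, le_rfl]
      have h1 : ∀ j, z' j ≤ 1 := fun j => by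
        simp only [hz']; split_ifs with h
        exacts [(hz _).2, zero_le_one]
      have hS' : 10 * (t : ℝ) ≤ ∑ j ∈ Finset.range n, z' j := by
        rw [← Fin.sum_univ_eq_sum_range z' n]
        rwa [hzz] at hS
      rw [hzz]
      refine (card_hashFamily_le_mul_card_balanced h2 h0 h1 hS').trans
        (Nat.mul_le_mul_right _ (le_trans ?_ hpow))
      calc 2 * sigWidth t * seeds t ^ 4 ≤ 2 * seeds t * seeds t ^ 4 := by
            gcongr; exact sigWidth_le_seeds ht
        _ = 2 * seeds t ^ 5 := by ring
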